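/- Let $U\subseteq\mathbb C^2$ be a nonempty open set with coordinates $(x,y)$, let $\partial_x,\partial_y$ be the derivatives with respect to the complex coordinates ($\partial_x=\frac12(\partial_{\mathrm{Re}\,x}-i\,\partial_{\mathrm{Im}\,x})$ and likewise $\partial_y$), let $\mathfrak D$ be the space of differential operators $T=\sum f_{ij}\,\partial_x^i\partial_y^j$ (finite sums, $f_{ij}\in C^\infty(U,\mathbb C)$), acting on $C^\infty(U,\mathbb C)$, and let $\mathfrak D^{(k)}$ be the subspace of operators of order at most $k$. Let $r\ge 2$ and $p,q,k\ge 0$ be integers. Put $$J^1=\partial_x,\quad J^2_p=x^2\partial_x+rxy\,\partial_y-px,\quad J^3_p=x\partial_x-\tfrac p2,\quad J^4=y\partial_y,\quad J^{5+i}=x^i\partial_y\ \ (0\le i\le r),$$ and let $\mathfrak g^{24,r}_p\simeq\mathfrak{gl}_2\ltimes\mathbb C^{r+1}$ be the Lie algebra that they span. Let $\mathcal S^r_{p,q}$ be the linear span of the monomials $x^iy^j$ with $i+rj\le p$ and $0\le j\le q$; let $\mathfrak S^r_{p,q}$ be the space of all $T\in\mathfrak D$ with $T(\mathcal S^r_{p,q})\subseteq\mathcal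 S^r_{p,q}$, and let $\pi^r_{p,q}:\mathfrak S^r_{p,q}\to\operatorname{End}(\mathcal S^r_{p,q})$ be the restriction map. Let $\tilde{\mathfrak S}^r_{p,q}$ be the space of those $T\in\mathfrak S^r_{p,q}$ that have the form $T=\sum_{i+rj\le p,\ j\le q}f_{ij}\,\partial_x^i\partial_y^j$. It is a complement of $\ker\pi^r_{p,q}$ in $\mathfrak S^r_{p,q}$. An operator $T$ has bidegree $(i,j)\in\mathbb Z^2$ if it maps each monomial $x^ay^b$ ($a,b\ge0$) to a multiple of $x^{a+i}y^{b+j}$ (to $0$ if one of these exponents is negative); its $y$-degree is then $j$. Let $\tilde{\mathfrak S}^{r\downarrow}_{p,q}$ be the subspace of $\tilde{\mathfrak S}^r_{p,q}$ spanned by its elements that have a bidegree with nonpositive $y$-degree. (a) The set of all monomials $$(J^{1+\epsilon}_p)^{s}(J^{5+\epsilon r})^j(J^3_p)^n(J^4)^m\quad\text{and}\quad (J^5)^{t}J^{5+i}(J^{5+r})^{j-t-1}(J^3_p)^n(J^4)^m$$ with $\epsilon\in\{0,1\}$, $0\le j\le q$, $0\le s\le p-jr$, $0\le t\le j-1$,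 $1\le i\le r-\delta_{t0}$, $n\ge 0$, $0\le m\le q-j$ and $n+rm\le p-\tilde s-jr$ (where $\tilde s=s$ for the first group and $\tilde s=0$ for the second) is contained in $\mathfrak S^r_{p,q}$, and the projections of these monomials to $\tilde{\mathfrak S}^r_{p,q}$ along $\ker\pi^r_{p,q}$ form a basis of $\tilde{\mathfrak S}^{r\downarrow}_{p,q}$ (distinct operators in the set having distinct projections). If $qr\le p$, then $$\dim\tilde{\mathfrak S}^{r\downarrow}_{p,q}=\frac{(q+1)(q+2)}2\Big((p+1)(p+1-qr)+\frac{qr^2}{12}(3q+1)\Big).$$ (b) Let $\rho^{r,k}_p:\bigoplus_{n=0}^kS^n(\mathfrak g^{24,r}_p)\to\mathfrak D^{(k)}$ be the linear map given on symmetric powers by symmetrized products, $v_1\cdots v_n\mapsto\frac1{n!}\sum_{\sigma}v_{\sigma(1)}\cdots v_{\sigma(n)}$. The set of all monomials $$(J^{1+\epsilon}_p)^{l-j}(J^{5+\epsilon r})^j(J^3_p)^n(J^4)^{t-l-n}\quad\text{and}\quad (J^5)^{s}J^{5+i}(J^{5+r})^{l-s-1}(J^3_p)^n(J^4)^{t-l-n}$$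 with $\epsilon\in\{0,1\}$, $0\le j\le l\le t\le k$, $0\le s\le l-1$, $0\le n\le t-l$ and $1\le i\le r-\delta_{s0}$ (the second group is absent for $l=0$) is a basis of $\operatorname{im}\rho^{r,k}_p$, and exactly $$\frac16(k+1)(k+2)\big((r+2)k+3\big)$$ elements of this basis are differential operators of order $k$. -/

import Mathlib

open scoped ContDiff TensorProduct

noncomputable section

namespace Staircase

open TopologicalSpace

/-- Extension by zero of a function on an open set `U` of `ℂ²`; it only serves to differentiate
at points of `U`. -/
def extend {U : Opens (ℂ × ℂ)} (f : U → ℂ) : ℂ × ℂ → ℂ :=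
  Function.extend Subtype.val f 0

theorem extend_coe {U : Opens (ℂ × ℂ)} (f : U → ℂ) (z : U) : extend f z = f z :=
  Subtype.val_injective.extend_apply f 0 z

theorem extend_congr {U : Opens (ℂ × ℂ)} (f : U → ℂ) (F : ℂ × ℂ → ℂ)
    (h : ∀ z : U, f z = F z) : Set.EqOn (extend f) F U := by
  intro z hz
  exact (extend_coe f ⟨z, hz⟩).trans (h ⟨z, hz⟩)

/-- The smooth complex-valued functions on the open set `U ⊆ ℂ²`, as a subalgebra of all
functions. -/
def smoothSubalgebra (U : Opens (ℂ × ℂ)) : Subalgebra ℂ (U → ℂ) where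
  carrier := {f | ContDiffOn ℝ ∞ (extend f) U}
  mul_mem' {f g} hf hg := (ContDiffOn.mul hf hg).congr
    (extend_congr _ _ fun z => by simp [extend_coe])
  add_mem' {f g} hf hg := (ContDiffOn.add hf hg).congr
    (extend_congr _ _ fun z => by simp [extend_coe])
  algebraMap_mem' c := (contDiffOn_const (c := c)).congr
    (extend_congr _ _ fun z => rfl)

variable (U : Opens (ℂ × ℂ))

/-- The algebra `C^∞(U, ℂ)`. -/
def Smooth : Type := smoothSubalgebra U

instance : CommRing (Smooth U) := inferInstanceAs (CommRing (smoothSubalgebra U))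

instance : Algebra ℂ (Smooth U) := inferInstanceAs (Algebra ℂ (smoothSubalgebra U))

variable {U} in
/-- The function underlying an element of `C^∞(U, ℂ)`. -/
def Smooth.fn (f : Smooth U) : U → ℂ := f.1

/-- The linear operators on `C^∞(U, ℂ)`. -/
abbrev Op : Type := Module.End ℂ (Smooth U)

instance (V : Submodule ℂ (Op U)) : AddCommGroup V := V.addCommGroup

variable {U} in
theorem contDiffOn_extend (f : Smooth U) : ContDiffOn ℝ ∞ (extend f.fn) U := f.2

variable {U} in
theorem differentiableAt_extend (f : Smooth U) (z : U) :
    DifferentiableAt ℝ (extend f.fn) z :=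
  ((contDiffOn_extend f).contDiffAt (U.2.mem_nhds z.2)).differentiableAt (by simp)

/-- The complex (Wirtinger) derivative of `F` at `z` in the direction `v`:
`½ (D_v F - i D_{iv} F)`. For holomorphic `F` it is the complex derivative in the
direction `v`; for `v = (1,0)`, `(0,1)` it is `∂/∂x`, `∂/∂y`, with `x`, `y` the complex
coordinates. -/
def wirtinger (v : ℂ × ℂ) (F : ℂ × ℂ → ℂ) (z : ℂ × ℂ) : ℂ :=
  (1 / 2) * (fderiv ℝ F z v - Complex.I * fderiv ℝ F z (Complex.I • v))

/-- The complex derivative in the direction `v` as a linear operator on `C^∞(U, ℂ)`. -/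
def partialD (v : ℂ × ℂ) : Op U where
  toFun f := ⟨fun z => wirtinger v (extend f.fn) z, by
    have hd : ContDiffOn ℝ ∞ (fderiv ℝ (extend f.fn)) U :=
      (contDiffOn_extend f).fderiv_of_isOpen U.2 (by simp)
    have h : ContDiffOn ℝ ∞ (wirtinger v (extend f.fn)) U :=
      contDiffOn_const.mul ((hd.clm_apply contDiffOn_const).sub
        (contDiffOn_const.mul (hd.clm_apply contDiffOn_const)))
    exact h.congr (extend_congr _ _ fun z => rfl)⟩
  map_add' f g := by
    refine Subtype.ext (funext fun z => ?_)
    have hz : (z : ℂ × ℂ) ∈ (U : Set (ℂ × ℂ)) := z.2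
    have e : extend (f + g).fn =ᶠ[nhds (z : ℂ × ℂ)] extend f.fn + extend g.fn :=
      Filter.eventuallyEq_of_mem (U.2.mem_nhds hz) (extend_congr _ _ fun w => by
        rw [Pi.add_apply, extend_coe, extend_coe]; rfl)
    change wirtinger v (extend (f + g).fn) z =
      wirtinger v (extend f.fn) z + wirtinger v (extend g.fn) z
    simp only [wirtinger, e.fderiv_eq,
      fderiv_add (differentiableAt_extend f z) (differentiableAt_extend g z), add_apply]
    ring
  map_smul' c f := by
    refine Subtype.ext (funext fun z => ?_)
    have hz : (z : ℂ × ℂ) ∈ (U : Set (ℂ × ℂ)) := z.2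
    have e : extend (c • f).fn =ᶠ[nhds (z : ℂ × ℂ)] c • extend f.fn :=
      Filter.eventuallyEq_of_mem (U.2.mem_nhds hz) (extend_congr _ _ fun w => by
        rw [Pi.smul_apply, extend_coe]; rfl)
    change wirtinger v (extend (c • f).fn) z = c * wirtinger v (extend f.fn) z
    simp only [wirtinger, e.fderiv_eq, fderiv_const_smul (differentiableAt_extend f z),
      smul_apply, smul_eq_mul]
    ring

/-- `∂_x`. -/
def dx : Op U := partialD U (1, 0)

/-- `∂_y`. -/
def dy : Op U := partialD U (0, 1)

/-- The coordinate function `x`. -/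
def X : Smooth U := ⟨fun z => (z : ℂ × ℂ).1,
  contDiff_fst.contDiffOn.congr (extend_congr _ _ fun _ => rfl)⟩

/-- The coordinate function `y`. -/
def Y : Smooth U := ⟨fun z => (z : ℂ × ℂ).2,
  contDiff_snd.contDiffOn.congr (extend_congr _ _ fun _ => rfl)⟩

variable {U} in
/-- The operator of multiplication by the function `f`. -/
def mulOp (f : Smooth U) : Op U := LinearMap.mulLeft ℂ f

/-- The operators `∑ f_{ij} ∂_x^i ∂_y^j` (finite sums, smooth coefficients `f_{ij}`) that only
involve the exponents `(i, j)` satisfying `P`. -/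
def diffOpOn (P : ℕ → ℕ → Prop) : Submodule ℂ (Op U) :=
  Submodule.span ℂ {T | ∃ (f : Smooth U) (i j : ℕ), P i j ∧ T = mulOp f * dx U ^ i * dy U ^ j}

/-- The space `𝔇` of all differential operators on `U`. -/
def diffOp : Submodule ℂ (Op U) := diffOpOn U fun _ _ => True

/-- The space `𝔇^{(k)}` of differential operators of order at most `k`. -/
def diffOpLE (k : ℕ) : Submodule ℂ (Op U) := diffOpOn U fun i j => i + j ≤ k

/-- `T` is a differential operator of order exactly `k`. -/
def HasOrder (T : Op U) (k : ℕ) : Prop :=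
  T ∈ diffOpLE U k ∧ ∀ l < k, T ∉ diffOpLE U l

/-- `T` has bidegree `(i, j)`: it maps each `x^a y^b` to a multiple of `x^{a+i} y^{b+j}`
(to `0` if one of the exponents `a + i`, `b + j` is negative). -/
def HasBidegree (T : Op U) (i j : ℤ) : Prop :=
  ∀ a b : ℕ, T (X U ^ a * Y U ^ b) ∈
    Submodule.span ℂ {g | ∃ c d : ℕ, (c : ℤ) = a + i ∧ (d : ℤ) = b + j ∧ g = X U ^ c * Y U ^ d}

/-- The staircase module `𝒮^r_{p,q}`, spanned by the `x^i y^j` with `i + r j ≤ p`, `j ≤ q`. -/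
def stair (r p q : ℕ) : Submodule ℂ (Smooth U) :=
  Submodule.span ℂ {g | ∃ i j : ℕ, i + r * j ≤ p ∧ j ≤ q ∧ g = X U ^ i * Y U ^ j}

/-- The space `𝔖^r_{p,q}` of the differential operators that preserve `𝒮^r_{p,q}`. -/
def preserving (r p q : ℕ) : Submodule ℂ (Op U) where
  carrier := {T | T ∈ diffOp U ∧ ∀ g ∈ stair U r p q, T g ∈ stair U r p q}
  add_mem' hS hT := ⟨add_mem hS.1 hT.1, fun g hg => add_mem (hS.2 g hg) (hT.2 g hg)⟩
  zero_mem' := ⟨zero_mem _, fun _ _ => zero_mem _⟩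
  smul_mem' c _ hT := ⟨Submodule.smul_mem _ c hT.1, fun g hg => Submodule.smul_mem _ c (hT.2 g hg)⟩

/-- `π^r_{p,q} : 𝔖^r_{p,q} → End(𝒮^r_{p,q})`, the restriction of operators to the module. -/
def restr (r p q : ℕ) : preserving U r p q →ₗ[ℂ] Module.End ℂ (stair U r p q) where
  toFun T := (T : Op U).restrict T.2.2
  map_add' _ _ := rfl
  map_smul' _ _ := rfl

/-- The distinguished complement `𝔖̃^r_{p,q}`: the operators in `𝔖^r_{p,q}` of the form
`∑ f_{ij} ∂_x^i ∂_y^j` with `i + r j ≤ p`, `j ≤ q`. -/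
def distinguished (r p q : ℕ) : Submodule ℂ (preserving U r p q) :=
  (diffOpOn U fun i j => i + r * j ≤ p ∧ j ≤ q).comap (preserving U r p q).subtype

/-- The part `𝔖̃^{r↓}_{p,q}` of `𝔖̃^r_{p,q}` of nonpositive `y`-degree, spanned by the homogeneous
elements of bidegree `(i, j)` with `j ≤ 0`. -/
def distinguishedDown (r p q : ℕ) : Submodule ℂ (preserving U r p q) :=
  Submodule.span ℂ {T | T ∈ distinguished U r p q ∧
    ∃ i j : ℤ, j ≤ 0 ∧ HasBidegree U (T : Op U) i j}

/-- The generators `J^1, …, J^{5+r}` of `𝔤^{24,r}_p` (the value at `0` is not used). -/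
def J (r p : ℕ) : ℕ → Op U
  | 0 => 0
  | 1 => dx U
  | 2 => mulOp (X U ^ 2) * dx U + (r : ℂ) • (mulOp (X U * Y U) * dy U) - (p : ℂ) • mulOp (X U)
  | 3 => mulOp (X U) * dx U - ((p : ℂ) / 2) • 1
  | 4 => mulOp (Y U) * dy U
  | i + 5 => mulOp (X U ^ i) * dy U

/-- The Lie algebra `𝔤^{24,r}_p`, as a vector space of operators: the linear span of its
generators. It is a faithful realization of `𝔤𝔩₂ ⋉ ℂ^{r+1}`. -/
def g24 (r p : ℕ) : Submodule ℂ (Op U) :=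
  Submodule.span ℂ {T | ∃ i : ℕ, 1 ≤ i ∧ i ≤ r + 5 ∧ T = J U r p i}

section Symmetrization

variable {A : Type} [Ring A] [Algebra ℂ A]

/-- `(v_1, …, v_n) ↦ (1/n!) ∑_σ v_{σ(1)} ⋯ v_{σ(n)}` for elements of a subspace `V` of an
associative algebra. -/
def symmProd (V : Submodule ℂ A) (n : ℕ) : MultilinearMap ℂ (fun _ : Fin n => V) A :=
  ((n.factorial : ℂ)⁻¹) • ∑ σ : Equiv.Perm (Fin n),
    ((MultilinearMap.mkPiAlgebraFin ℂ n A).compLinearMap fun _ => V.subtype).domDomCongr σ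

theorem symmProd_perm (V : Submodule ℂ A) (n : ℕ) (e : Equiv.Perm (Fin n)) (v : Fin n → V) :
    symmProd V n (fun i => v (e i)) = symmProd V n v := by
  simp only [symmProd, smul_apply, sum_apply,
    MultilinearMap.domDomCongr_apply]
  congr 1
  exact Fintype.sum_equiv (Equiv.mulLeft e) _ _ fun σ => rfl

/-- The linear map `S^n(V) → A` on the `n`-th symmetric power, determined by the inclusion
`V ⊆ A` through symmetrized products. -/
def symmPow (V : Submodule ℂ A) (n : ℕ) : SymmetricPower ℂ (Fin n) V →ₗ[ℂ] A where
  toFun := AddCon.lift _ (PiTensorProduct.lift (symmProd V n)).toAddMonoidHom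
    (AddCon.addConGen_le.2 fun x y h => by
      cases h with
      | perm e f =>
        have h1 := PiTensorProduct.lift.tprod (φ := symmProd V n) f
        have h2 := PiTensorProduct.lift.tprod (φ := symmProd V n) fun i => f (e i)
        exact h1.trans ((symmProd_perm V n e f).symm.trans h2.symm))
  map_add' x y := map_add _ x y
  map_smul' c x := AddCon.induction_on x fun x => by
    exact (PiTensorProduct.lift (symmProd V n)).map_smul c x

/-- On pure symmetric tensors `symmPow` is the symmetrized product. -/
theorem symmPow_tprod (V : Submodule ℂ A) (n : ℕ) (v : Fin n → V) :
    symmPow V n (SymmetricPower.tprod ℂ v) = symmProd V n v :=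
  PiTensorProduct.lift.tprod v

/-- The linear map `⨁_{n ≤ k} S^n(V) → A` with the components `symmPow`. -/
def symmUpTo (V : Submodule ℂ A) (k : ℕ) :
    (∀ n : Fin (k + 1), SymmetricPower ℂ (Fin n) V) →ₗ[ℂ] A :=
  ∑ n : Fin (k + 1), symmPow V n ∘ₗ LinearMap.proj n

end Symmetrization

/-- `ρ^{r,k}_p : ⨁_{n ≤ k} S^n(𝔤𝔩₂ ⋉ ℂ^{r+1}) → 𝔇`. -/
def rho (r p k : ℕ) :
    (∀ n : Fin (k + 1), SymmetricPower ℂ (Fin n) (g24 U r p)) →ₗ[ℂ] Op U :=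
  symmUpTo (g24 U r p) k

/-- The monomials whose projections are to form a basis of `𝔖̃^{r↓}_{p,q}`. -/
def effMonomials (r p q : ℕ) : Set (Op U) :=
  {T | ∃ ε s j n m : ℕ, ε ≤ 1 ∧ j ≤ q ∧ s + j * r ≤ p ∧ m + j ≤ q ∧ n + r * m + s + j * r ≤ p ∧
      T = J U r p (ε + 1) ^ s * J U r p (ε * r + 5) ^ j * J U r p 3 ^ n * J U r p 4 ^ m} ∪
  {T | ∃ t i j n m : ℕ, j ≤ q ∧ t + 1 ≤ j ∧ 1 ≤ i ∧ i ≤ (if t = 0 then r - 1 else r) ∧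
      m + j ≤ q ∧ n + r * m + j * r ≤ p ∧
      T = J U r p 5 ^ t * J U r p (i + 5) * J U r p (r + 5) ^ (j - t - 1) *
        J U r p 3 ^ n * J U r p 4 ^ m}

/-- The monomials that are to form a basis of the image of `ρ^{r,k}_p`. -/
def bigMonomials (r p k : ℕ) : Set (Op U) :=
  {T | ∃ ε j l t n : ℕ, ε ≤ 1 ∧ j ≤ l ∧ l ≤ t ∧ t ≤ k ∧ n ≤ t - l ∧
      T = J U r p (ε + 1) ^ (l - j) * J U r p (ε * r + 5) ^ j *
        J U r p 3 ^ n * J U r p 4 ^ (t - l - n)} ∪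
  {T | ∃ s i l t n : ℕ, s + 1 ≤ l ∧ l ≤ t ∧ t ≤ k ∧ n ≤ t - l ∧
      1 ≤ i ∧ i ≤ (if s = 0 then r - 1 else r) ∧
      T = J U r p 5 ^ s * J U r p (i + 5) * J U r p (r + 5) ^ (l - s - 1) *
        J U r p 3 ^ n * J U r p 4 ^ (t - l - n)}

end Staircase

end

/-!
A differential operator is determined by its values on the monomials `x^a y^b`. An operator of
bidegree `(d, e)` multiplies `x^a y^b` by a scalar `c(a, b)`, its symbol, while shifting the
exponents by `(d, e)`. Each monomial in the generators that occurs in the theorem is a leading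
factor times `(J^3)^n (J^4)^m`. There is exactly one leading factor for each bidegree `(d, -j)`
with `j ≥ 0`: it consists of `j` generators `x^i ∂_y`, of `max(-d, 0)` factors `J^1` and of
`max(d - r j, 0)` factors `J^2`. The symbol of the whole monomial is that of the leading factor
times `(a - p/2)^n b^m`.

Linear independence is therefore a question about one bidegree at a time, where it says that a
polynomial in `a` and `b` whose exponents lie in a lower set of `ℕ²` vanishes if it does so on a
translate of that set. In part (a) spanning follows by comparing dimensions: an operator in the
distinguished complement is a matrix on the staircase module, and the matrix units of
nonpositive `y`-degree are in bijection with the listed monomials. In part (b) the image of `ρ` is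
the span of all products of at most `k` generators, since reordering factors costs commutators, that
is, shorter products. The span of the listed monomials contains these products: it absorbs
left multiplication by a generator, as one reads off from the symbols. Finally, the order of a
homogeneous operator is at least the degree of its symbol restricted to the diagonal `a = b`,
which for a listed monomial is the number of its factors.
-/

noncomputable section

namespace Staircase

open TopologicalSpace Finset

variable {U : Opens (ℂ × ℂ)}

/-! ### Smooth functions, monomials and differential operators -/

theorem Smooth.ext_fn {f g : Smooth U} (h : ∀ z, f.fn z = g.fn z) : f = g :=
  Subtype.ext (funext h)

@[simp] theorem fn_mul (f g : Smooth U) (z : U) : (f * g).fn z = f.fn z * g.fn z := rfl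

@[simp] theorem fn_add (f g : Smooth U) (z : U) : (f + g).fn z = f.fn z + g.fn z := rfl

@[simp] theorem fn_smul (c : ℂ) (f : Smooth U) (z : U) : (c • f).fn z = c * f.fn z := rfl

@[simp] theorem fn_zero (z : U) : (0 : Smooth U).fn z = 0 := rfl

theorem fn_partialD (v : ℂ × ℂ) (f : Smooth U) (z : U) :
    (partialD U v f).fn z = wirtinger v (extend f.fn) z := rfl

theorem extend_eventuallyEq (f : U → ℂ) (F : ℂ × ℂ → ℂ) (h : ∀ z : U, f z = F z) (z : U) :
    extend f =ᶠ[nhds (z : ℂ × ℂ)] F :=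
  Filter.eventuallyEq_of_mem (U.2.mem_nhds z.2) (extend_congr f F h)

theorem wirtinger_congr {v : ℂ × ℂ} {F G : ℂ × ℂ → ℂ} {z : ℂ × ℂ} (h : F =ᶠ[nhds z] G) :
    wirtinger v F z = wirtinger v G z := by
  simp only [wirtinger, h.fderiv_eq]

theorem partialD_mul (v : ℂ × ℂ) (f g : Smooth U) :
    partialD U v (f * g) = f * partialD U v g + g * partialD U v f := by
  refine Smooth.ext_fn fun z => ?_
  have extend_mul := extend_eventuallyEq (f * g).fn (extend f.fn * extend g.fn)
    (fun w => by rw [Pi.mul_apply, extend_coe, extend_coe]; rfl) z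
  rw [fn_partialD, wirtinger_congr extend_mul]
  simp only [fn_add, fn_mul, fn_partialD, wirtinger,
    fderiv_mul (differentiableAt_extend f z) (differentiableAt_extend g z), add_apply, smul_apply,
    extend_coe, smul_eq_mul]
  ring

/-- The complex derivative in the direction `v` as a derivation of `C^∞(U, ℂ)`. -/
def partialDer (v : ℂ × ℂ) : Derivation ℂ (Smooth U) (Smooth U) :=
  Derivation.mk' (partialD U v) (partialD_mul v)

theorem partialD_pow (v : ℂ × ℂ) (f : Smooth U) (n : ℕ) :
    partialD U v (f ^ n) = (n : ℂ) • (f ^ (n - 1) * partialD U v f) := by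
  change partialDer v (f ^ n) = (n : ℂ) • (f ^ (n - 1) * partialDer v f)
  rw [Derivation.leibniz_pow, smul_eq_mul, Nat.cast_smul_eq_nsmul]

theorem partialD_of_eq_linear (v : ℂ × ℂ) (L : ℂ × ℂ →L[ℂ] ℂ) {f : Smooth U}
    (hf : ∀ z : U, f.fn z = L z) : partialD U v f = algebraMap ℂ (Smooth U) (L v) := by
  refine Smooth.ext_fn fun z => ?_
  rw [fn_partialD, wirtinger_congr (extend_eventuallyEq f.fn (L.restrictScalars ℝ) hf z)]
  simp only [wirtinger, ContinuousLinearMap.fderiv]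
  change (1 / 2 : ℂ) * (L v - Complex.I * L (Complex.I • v)) = L v
  rw [map_smul, smul_eq_mul, ← mul_assoc, Complex.I_mul_I]
  ring

theorem partialD_X (v : ℂ × ℂ) : partialD U v (X U) = algebraMap ℂ _ v.1 :=
  partialD_of_eq_linear v (ContinuousLinearMap.fst ℂ ℂ ℂ) fun _ => rfl

theorem partialD_Y (v : ℂ × ℂ) : partialD U v (Y U) = algebraMap ℂ _ v.2 :=
  partialD_of_eq_linear v (ContinuousLinearMap.snd ℂ ℂ ℂ) fun _ => rfl

theorem fderiv_wirtinger {F : ℂ × ℂ → ℂ} {z : ℂ × ℂ} (hF : DifferentiableAt ℝ (fderiv ℝ F) z)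
    (v w : ℂ × ℂ) : fderiv ℝ (wirtinger v F) z w =
      (1 / 2) * (fderiv ℝ (fderiv ℝ F) z w v
        - Complex.I * fderiv ℝ (fderiv ℝ F) z w (Complex.I • v)) := by
  have hasFDerivAt_apply (u : ℂ × ℂ) :
      HasFDerivAt (fun y => fderiv ℝ F y u) ((fderiv ℝ (fderiv ℝ F) z).flip u) z := by
    simpa using hF.hasFDerivAt.clm_apply (hasFDerivAt_const u z)
  have hasFDerivAt_wirtinger : HasFDerivAt (wirtinger v F) _ z :=
    ((hasFDerivAt_apply v).sub ((hasFDerivAt_apply (Complex.I • v)).const_mul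
      Complex.I)).const_mul (1 / 2 : ℂ)
  rw [hasFDerivAt_wirtinger.fderiv]
  simp

theorem partialD_comm (v w : ℂ × ℂ) (f : Smooth U) :
    partialD U v (partialD U w f) = partialD U w (partialD U v f) := by
  refine Smooth.ext_fn fun z => ?_
  have contDiffAt : ContDiffAt ℝ ∞ (extend f.fn) z :=
    (contDiffOn_extend f).contDiffAt (U.2.mem_nhds z.2)
  have symm : IsSymmSndFDerivAt ℝ (extend f.fn) z := contDiffAt.isSymmSndFDerivAt (by
    rw [minSmoothness_of_isRCLikeNormedField]; exact WithTop.coe_le_coe.2 le_top)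
  have differentiableAt : DifferentiableAt ℝ (fderiv ℝ (extend f.fn)) (z : ℂ × ℂ) :=
    (contDiffAt.fderiv_right (m := 1) (WithTop.coe_le_coe.2 le_top)).differentiableAt one_ne_zero
  have extend_partialD (u : ℂ × ℂ) :=
    extend_eventuallyEq (partialD U u f).fn (wirtinger u (extend f.fn)) (fn_partialD u f) z
  rw [fn_partialD, fn_partialD, wirtinger_congr (extend_partialD w),
    wirtinger_congr (extend_partialD v)]
  rw [wirtinger, wirtinger]
  simp only [fderiv_wirtinger differentiableAt]
  rw [symm v w, symm v (Complex.I • w), symm (Complex.I • v) w,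
    symm (Complex.I • v) (Complex.I • w)]
  ring

theorem dx_commute_dy : Commute (dx U) (dy U) :=
  LinearMap.ext fun f => partialD_comm _ _ f

theorem mulOp_eq_lmul (f : Smooth U) : mulOp f = Algebra.lmul ℂ (Smooth U) f := rfl

theorem mulOp_mul_mulOp (f g : Smooth U) : mulOp f * mulOp g = mulOp (f * g) :=
  (map_mul (Algebra.lmul ℂ (Smooth U)) f g).symm

theorem partialD_mul_mulOp (v : ℂ × ℂ) (f : Smooth U) :
    partialD U v * mulOp f = mulOp (partialD U v f) + mulOp f * partialD U v :=
  LinearMap.ext fun g => (partialD_mul v f g).trans (by rw [add_comm, mul_comm]; rfl)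

variable (U) in
/-- The monomial `x^a y^b`. -/
def mon (a b : ℕ) : Smooth U := X U ^ a * Y U ^ b

theorem mon_mul_mon (a b c d : ℕ) : mon U a b * mon U c d = mon U (a + c) (b + d) := by
  simp only [mon, pow_add]
  exact mul_mul_mul_comm _ _ _ _

theorem mon_zero_zero : mon U 0 0 = 1 := by
  rw [mon, pow_zero, pow_zero, mul_one]

theorem X_pow_eq_mon (i : ℕ) : X U ^ i = mon U i 0 := by
  rw [mon, pow_zero, mul_one]

theorem fn_mon (a b : ℕ) (z : U) : (mon U a b).fn z = (z : ℂ × ℂ).1 ^ a * (z : ℂ × ℂ).2 ^ b := rfl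

theorem dx_mon (a b : ℕ) : dx U (mon U a b) = (a : ℂ) • mon U (a - 1) b := by
  rw [dx, mon, partialD_mul, partialD_pow, partialD_pow, partialD_X, partialD_Y]
  simp [mon, mul_comm]

theorem dy_mon (a b : ℕ) : dy U (mon U a b) = (b : ℂ) • mon U a (b - 1) := by
  rw [dy, mon, partialD_mul, partialD_pow, partialD_pow, partialD_X, partialD_Y]
  simp [mon]

theorem dx_pow_mon (i a b : ℕ) :
    (dx U ^ i) (mon U a b) = (a.descFactorial i : ℂ) • mon U (a - i) b := by
  induction i with
  | zero => simp
  | succ i ih =>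
    rw [pow_succ', Module.End.mul_apply, ih, map_smul, dx_mon, smul_smul, Nat.sub_sub, mul_comm,
      Nat.descFactorial_succ, Nat.cast_mul]

theorem dy_pow_mon (i a b : ℕ) :
    (dy U ^ i) (mon U a b) = (b.descFactorial i : ℂ) • mon U a (b - i) := by
  induction i with
  | zero => simp
  | succ i ih =>
    rw [pow_succ', Module.End.mul_apply, ih, map_smul, dy_mon, smul_smul, Nat.sub_sub, mul_comm,
      Nat.descFactorial_succ, Nat.cast_mul]

theorem mulOp_mul_dx_pow_mul_dy_pow_mon (f : Smooth U) (i j a b : ℕ) :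
    (mulOp f * dx U ^ i * dy U ^ j) (mon U a b) =
      ((a.descFactorial i : ℂ) * b.descFactorial j) • (f * mon U (a - i) (b - j)) := by
  rw [Module.End.mul_apply, Module.End.mul_apply, dy_pow_mon, map_smul, dx_pow_mon, smul_smul,
    map_smul, mul_comm]
  rfl

theorem exists_mem_ne_zero (hU : (U : Set (ℂ × ℂ)).Nonempty) :
    ∃ z : U, (z : ℂ × ℂ).1 ≠ 0 ∧ (z : ℂ × ℂ).2 ≠ 0 := by
  have dense : Dense (({0}ᶜ : Set ℂ) ×ˢ ({0}ᶜ : Set ℂ)) :=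
    (dense_compl_singleton 0).prod (dense_compl_singleton 0)
  obtain ⟨z, hz, h⟩ := dense.inter_open_nonempty U U.2 hU
  exact ⟨⟨z, hz⟩, h.1, h.2⟩

theorem mon_ne_zero (hU : (U : Set (ℂ × ℂ)).Nonempty) (a b : ℕ) : mon U a b ≠ 0 := by
  obtain ⟨z, hx, hy⟩ := exists_mem_ne_zero hU
  intro h
  have fn_eq_zero := fn_mon a b z
  rw [h, fn_zero] at fn_eq_zero
  exact mul_ne_zero (pow_ne_zero a hx) (pow_ne_zero b hy) fn_eq_zero.symm

theorem mulOp_X_mul_dx_mon (a b : ℕ) : (mulOp (X U) * dx U) (mon U a b) = (a : ℂ) • mon U a b := by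
  have h := mulOp_mul_dx_pow_mul_dy_pow_mon (X U) 1 0 a b
  rw [pow_one, pow_zero, mul_one] at h
  rw [h]
  cases a with
  | zero => simp
  | succ a =>
    rw [← pow_one (X U), X_pow_eq_mon, mon_mul_mon, Nat.add_sub_cancel, add_comm 1]
    simp

theorem mulOp_Y_mul_dy_mon (a b : ℕ) : (mulOp (Y U) * dy U) (mon U a b) = (b : ℂ) • mon U a b := by
  have h := mulOp_mul_dx_pow_mul_dy_pow_mon (Y U) 0 1 a b
  rw [pow_one, pow_zero, mul_one] at h
  have Y_eq_mon : Y U = mon U 0 1 := by rw [mon, pow_zero, one_mul, pow_one]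
  rw [h]
  cases b with
  | zero => simp
  | succ b =>
    rw [Y_eq_mon, mon_mul_mon, Nat.add_sub_cancel, add_comm 1]
    simp

/-- The monomials are eigenvectors of `x∂_x + i y∂_y` with the distinct eigenvalues `a + i b`. -/
theorem linearIndependent_mon (hU : (U : Set (ℂ × ℂ)).Nonempty) :
    LinearIndependent ℂ fun α : ℕ × ℕ => mon U α.1 α.2 := by
  refine Module.End.eigenvectors_linearIndependent'
    (mulOp (X U) * dx U + Complex.I • (mulOp (Y U) * dy U))
    (fun α : ℕ × ℕ => (α.1 : ℂ) + Complex.I * α.2) ?_ _ fun α => ⟨?_, mon_ne_zero hU _ _⟩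
  · rintro ⟨a, b⟩ ⟨c, d⟩ h
    have re_eq : a = c := by simpa using congrArg Complex.re h
    have im_eq : b = d := by simpa using congrArg Complex.im h
    rw [re_eq, im_eq]
  · rw [Module.End.mem_eigenspace_iff, LinearMap.add_apply, LinearMap.smul_apply,
      mulOp_X_mul_dx_mon, mulOp_Y_mul_dy_mon, add_smul, mul_smul]

theorem diffOpOn_mono {P Q : ℕ → ℕ → Prop} (h : ∀ i j, P i j → Q i j) :
    diffOpOn U P ≤ diffOpOn U Q :=
  Submodule.span_mono fun _ ⟨f, i, j, hP, hT⟩ => ⟨f, i, j, h i j hP, hT⟩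

theorem mulOp_mul_dx_pow_mul_dy_pow_mem {P : ℕ → ℕ → Prop} (f : Smooth U) {i j : ℕ} (h : P i j) :
    mulOp f * dx U ^ i * dy U ^ j ∈ diffOpOn U P :=
  Submodule.subset_span ⟨f, i, j, h, rfl⟩

variable (U) in
/-- The differential operator `∑ f_{ij} ∂_x^i ∂_y^j` with prescribed coefficients `f_{ij}`. -/
def ofCoeffs : (ℕ × ℕ →₀ Smooth U) →ₗ[ℂ] Op U :=
  Finsupp.lsum ℂ fun α =>
    LinearMap.mulRight ℂ (dx U ^ α.1 * dy U ^ α.2) ∘ₗ (Algebra.lmul ℂ (Smooth U)).toLinearMap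

theorem ofCoeffs_apply (F : ℕ × ℕ →₀ Smooth U) :
    ofCoeffs U F = ∑ α ∈ F.support, mulOp (F α) * dx U ^ α.1 * dy U ^ α.2 :=
  Finset.sum_congr rfl fun _ _ => (mul_assoc _ _ _).symm

theorem diffOpOn_le_map_supported (P : ℕ → ℕ → Prop) :
    diffOpOn U P ≤ (Finsupp.supported (Smooth U) ℂ {α | P α.1 α.2}).map (ofCoeffs U) := by
  refine Submodule.span_le.2 ?_
  rintro _ ⟨f, i, j, hP, rfl⟩
  refine ⟨Finsupp.single (i, j) f, Finsupp.single_mem_supported ℂ f hP, ?_⟩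
  exact (Finsupp.lsum_single ℂ _ _ f).trans (mul_assoc _ _ _).symm

theorem ofCoeffs_mon_of_forall_lt {F : ℕ × ℕ →₀ Smooth U} {α : ℕ × ℕ}
    (h : ∀ β < α, F β = 0) :
    ofCoeffs U F (mon U α.1 α.2) = ((α.1.factorial : ℂ) * α.2.factorial) • F α := by
  rw [ofCoeffs_apply, LinearMap.sum_apply, Finset.sum_eq_single α]
  · rw [mulOp_mul_dx_pow_mul_dy_pow_mon, Nat.descFactorial_self, Nat.descFactorial_self,
      Nat.sub_self, Nat.sub_self, mon_zero_zero, mul_one]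
  · intro β hβ hne
    rw [mulOp_mul_dx_pow_mul_dy_pow_mon]
    have hnle : ¬ β ≤ α := fun hle =>
      Finsupp.mem_support_iff.1 hβ (h β (lt_of_le_of_ne hle hne))
    rw [Prod.le_def, not_and_or, not_le, not_le] at hnle
    rcases hnle with hlt | hlt <;> simp [Nat.descFactorial_of_lt hlt]
  · intro hα
    rw [Finsupp.notMem_support_iff.1 hα]
    simp [mulOp_eq_lmul]

/-- The lowest nonvanishing coefficient would be visible at the monomial with its exponent. -/
theorem eq_zero_of_mon {P : ℕ → ℕ → Prop} {T : Op U} (hT : T ∈ diffOpOn U P)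
    (h : ∀ a b, P a b → T (mon U a b) = 0) : T = 0 := by
  obtain ⟨F, hF, rfl⟩ := diffOpOn_le_map_supported P hT
  rcases F.support.eq_empty_or_nonempty with hempty | hne
  · rw [Finsupp.support_eq_empty.1 hempty, map_zero]
  · obtain ⟨α, hα, hmin⟩ := F.support.exists_minimal hne
    have lower_eq_zero : ∀ β < α, F β = 0 := fun β hβ => by
      by_contra hne
      exact hβ.not_ge (hmin (Finsupp.mem_support_iff.2 hne) hβ.le)
    have apply_eq_zero := h α.1 α.2 (hF hα)
    rw [ofCoeffs_mon_of_forall_lt lower_eq_zero, smul_eq_zero] at apply_eq_zero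
    have factorial_ne_zero : (α.1.factorial : ℂ) * α.2.factorial ≠ 0 := by
      exact_mod_cast mul_ne_zero α.1.factorial_ne_zero α.2.factorial_ne_zero
    exact absurd (apply_eq_zero.resolve_left factorial_ne_zero) (Finsupp.mem_support_iff.1 hα)

theorem eq_of_mon {P : ℕ → ℕ → Prop} {S T : Op U} (hS : S ∈ diffOpOn U P)
    (hT : T ∈ diffOpOn U P) (h : ∀ a b, P a b → S (mon U a b) = T (mon U a b)) : S = T :=
  sub_eq_zero.1 <| eq_zero_of_mon (sub_mem hS hT) fun a b hab => by
    rw [LinearMap.sub_apply, h a b hab, sub_self]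

theorem diffOpLE_mono {k l : ℕ} (h : k ≤ l) : diffOpLE U k ≤ diffOpLE U l :=
  diffOpOn_mono fun _ _ h' => h'.trans h

theorem diffOpLE_le (k : ℕ) : diffOpLE U k ≤ diffOp U := diffOpOn_mono fun _ _ _ => trivial

theorem one_mem_diffOpLE (k : ℕ) : (1 : Op U) ∈ diffOpLE U k := by
  have h := mulOp_mul_dx_pow_mul_dy_pow_mem (P := fun i j => i + j ≤ k) (1 : Smooth U)
    (i := 0) (j := 0) (by omega)
  rwa [mulOp_eq_lmul, map_one, pow_zero, pow_zero, mul_one, mul_one] at h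

theorem mulOp_mul_mem_diffOpOn {P : ℕ → ℕ → Prop} (f : Smooth U) {T : Op U}
    (hT : T ∈ diffOpOn U P) : mulOp f * T ∈ diffOpOn U P := by
  suffices diffOpOn U P ≤ (diffOpOn U P).comap (LinearMap.mulLeft ℂ (mulOp f)) from this hT
  refine Submodule.span_le.2 ?_
  rintro _ ⟨g, i, j, h, rfl⟩
  change mulOp f * (mulOp g * dx U ^ i * dy U ^ j) ∈ diffOpOn U P
  rw [← mul_assoc, ← mul_assoc, mulOp_mul_mulOp]
  exact mulOp_mul_dx_pow_mul_dy_pow_mem _ h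

theorem dx_mul_mem_diffOpLE {k : ℕ} {T : Op U} (hT : T ∈ diffOpLE U k) :
    dx U * T ∈ diffOpLE U (k + 1) := by
  suffices diffOpLE U k ≤ (diffOpLE U (k + 1)).comap (LinearMap.mulLeft ℂ (dx U)) from this hT
  refine Submodule.span_le.2 ?_
  rintro _ ⟨g, i, j, h, rfl⟩
  have leibniz : dx U * (mulOp g * dx U ^ i * dy U ^ j) =
      mulOp (dx U g) * dx U ^ i * dy U ^ j + mulOp g * dx U ^ (i + 1) * dy U ^ j := by
    rw [pow_succ', ← mul_assoc, ← mul_assoc, ← mul_assoc, ← add_mul, ← add_mul, dx,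
      partialD_mul_mulOp]
  change dx U * (mulOp g * dx U ^ i * dy U ^ j) ∈ diffOpLE U (k + 1)
  rw [leibniz]
  exact add_mem (mulOp_mul_dx_pow_mul_dy_pow_mem _ (by omega))
    (mulOp_mul_dx_pow_mul_dy_pow_mem _ (by omega))

theorem dy_mul_mem_diffOpLE {k : ℕ} {T : Op U} (hT : T ∈ diffOpLE U k) :
    dy U * T ∈ diffOpLE U (k + 1) := by
  suffices diffOpLE U k ≤ (diffOpLE U (k + 1)).comap (LinearMap.mulLeft ℂ (dy U)) from this hT
  refine Submodule.span_le.2 ?_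
  rintro _ ⟨g, i, j, h, rfl⟩
  have leibniz : dy U * (mulOp g * dx U ^ i * dy U ^ j) =
      mulOp (dy U g) * dx U ^ i * dy U ^ j + mulOp g * dx U ^ i * dy U ^ (j + 1) := by
    rw [pow_succ', ← mul_assoc, ← mul_assoc, ← mul_assoc, mul_assoc (mulOp g) (dx U ^ i),
      (dx_commute_dy.pow_left i).eq, ← mul_assoc, ← add_mul, ← add_mul, dy, partialD_mul_mulOp]
  change dy U * (mulOp g * dx U ^ i * dy U ^ j) ∈ diffOpLE U (k + 1)
  rw [leibniz]
  exact add_mem (mulOp_mul_dx_pow_mul_dy_pow_mem _ (by omega))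
    (mulOp_mul_dx_pow_mul_dy_pow_mem _ (by omega))

theorem dx_pow_mul_mem_diffOpLE (i : ℕ) {k : ℕ} {T : Op U} (hT : T ∈ diffOpLE U k) :
    dx U ^ i * T ∈ diffOpLE U (k + i) := by
  induction i with
  | zero => simpa using hT
  | succ i ih => rw [pow_succ', mul_assoc]; exact dx_mul_mem_diffOpLE ih

theorem dy_pow_mul_mem_diffOpLE (j : ℕ) {k : ℕ} {T : Op U} (hT : T ∈ diffOpLE U k) :
    dy U ^ j * T ∈ diffOpLE U (k + j) := by
  induction j with
  | zero => simpa using hT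
  | succ j ih => rw [pow_succ', mul_assoc]; exact dy_mul_mem_diffOpLE ih

theorem diffOpLE_mul_le (k l : ℕ) : diffOpLE U k * diffOpLE U l ≤ diffOpLE U (k + l) := by
  refine Submodule.mul_le.2 fun S hS T hT => ?_
  suffices diffOpLE U k ≤ (diffOpLE U (k + l)).comap (LinearMap.mulRight ℂ T) from this hS
  refine Submodule.span_le.2 ?_
  rintro _ ⟨f, i, j, h, rfl⟩
  change mulOp f * dx U ^ i * dy U ^ j * T ∈ diffOpLE U (k + l)
  rw [mul_assoc, mul_assoc]
  exact mulOp_mul_mem_diffOpOn f (diffOpLE_mono (by omega)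
    (dx_pow_mul_mem_diffOpLE i (dy_pow_mul_mem_diffOpLE j hT)))

theorem diffOpLE_one_pow_le (k : ℕ) : diffOpLE U 1 ^ k ≤ diffOpLE U k := by
  induction k with
  | zero => rw [Submodule.pow_zero, Submodule.one_le]; exact one_mem_diffOpLE 0
  | succ k ih =>
    rw [Submodule.pow_succ]
    exact (mul_le_mul' ih le_rfl).trans (diffOpLE_mul_le k 1)

/-! ### Operators that are homogeneous on monomials -/

/-- The operator `T` is homogeneous of bidegree `(d, e)` with symbol `c`: it maps `x^a y^b` to
`c(a, b) x^{a+d} y^{b+e}`, where `c(a, b) = 0` if one of the exponents on the right is negative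
(so that their truncation by `Int.toNat` is harmless). -/
def HasSymbol (T : Op U) (d e : ℤ) (c : ℂ → ℂ → ℂ) : Prop :=
  ∀ a b : ℕ, (c a b ≠ 0 → 0 ≤ a + d ∧ 0 ≤ b + e) ∧
    T (mon U a b) = c a b • mon U (a + d).toNat (b + e).toNat

namespace HasSymbol

variable {S T : Op U} {d e d₁ e₁ d₂ e₂ : ℤ} {c c₁ c₂ : ℂ → ℂ → ℂ}

theorem congr (hT : HasSymbol T d₁ e₁ c₁) (hd : d₁ = d₂) (he : e₁ = e₂)
    (hc : ∀ a b : ℕ, c₁ a b = c₂ a b) : HasSymbol T d₂ e₂ c₂ := by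
  subst hd he
  exact fun a b => hc a b ▸ hT a b

theorem zero (d e : ℤ) : HasSymbol (0 : Op U) d e fun _ _ => 0 := fun a b => by simp

theorem one : HasSymbol (1 : Op U) 0 0 fun _ _ => 1 := fun a b => by simp

theorem add (hS : HasSymbol S d e c₁) (hT : HasSymbol T d e c₂) :
    HasSymbol (S + T) d e fun a b => c₁ a b + c₂ a b := by
  intro a b
  refine ⟨fun h => ?_, by rw [LinearMap.add_apply, (hS a b).2, (hT a b).2, add_smul]⟩
  by_cases h₁ : c₁ a b = 0
  · exact (hT a b).1 fun h₂ => h (by simp only [h₁, h₂, add_zero])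
  · exact (hS a b).1 h₁

theorem smul (hT : HasSymbol T d e c) (κ : ℂ) : HasSymbol (κ • T) d e fun a b => κ * c a b :=
  fun a b => ⟨fun h => (hT a b).1 (right_ne_zero_of_mul h),
    by rw [LinearMap.smul_apply, (hT a b).2, smul_smul]⟩

theorem sub (hS : HasSymbol S d e c₁) (hT : HasSymbol T d e c₂) :
    HasSymbol (S - T) d e fun a b => c₁ a b - c₂ a b := by
  rw [sub_eq_add_neg, ← neg_one_smul ℂ T]
  exact (hS.add (hT.smul (-1))).congr rfl rfl fun a b => by ring

theorem sum {ι : Type*} {s : Finset ι} {T : ι → Op U} {c : ι → ℂ → ℂ → ℂ}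
    (hT : ∀ i ∈ s, HasSymbol (T i) d e (c i)) :
    HasSymbol (∑ i ∈ s, T i) d e fun a b => ∑ i ∈ s, c i a b := by
  induction s using Finset.cons_induction with
  | empty => simpa using zero d e
  | cons i s hi ih =>
    simp only [Finset.sum_cons]
    exact (hT i (mem_cons_self i s)).add (ih fun j hj => hT j (mem_cons_of_mem hj))

theorem mul (hS : HasSymbol S d₁ e₁ c₁) (hT : HasSymbol T d₂ e₂ c₂) :
    HasSymbol (S * T) (d₁ + d₂) (e₁ + e₂) fun a b => c₂ a b * c₁ (a + d₂) (b + e₂) := by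
  intro a b
  rw [Module.End.mul_apply, (hT a b).2, map_smul]
  by_cases h : c₂ a b = 0
  · simp [h]
  · obtain ⟨ha, hb⟩ := (hT a b).1 h
    have cast_a : ((a + d₂).toNat : ℂ) = a + d₂ := by exact_mod_cast Int.toNat_of_nonneg ha
    have cast_b : ((b + e₂).toNat : ℂ) = b + e₂ := by exact_mod_cast Int.toNat_of_nonneg hb
    obtain ⟨hne, happly⟩ := hS (a + d₂).toNat (b + e₂).toNat
    rw [cast_a, cast_b] at hne happly
    rw [happly, smul_smul]
    refine ⟨fun h => ?_, ?_⟩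
    · have := hne (right_ne_zero_of_mul h)
      omega
    · congr 2 <;> omega

theorem pow (hT : HasSymbol T d e c) (n : ℕ) :
    HasSymbol (T ^ n) (n * d) (n * e) fun a b => ∏ h ∈ range n, c (a + h * d) (b + h * e) := by
  induction n with
  | zero => exact one.congr (by simp) (by simp) fun _ _ => by simp
  | succ n ih =>
    rw [pow_succ']
    refine (hT.mul ih).congr (by push_cast; ring) (by push_cast; ring) fun a b => ?_
    rw [Finset.prod_range_succ]
    push_cast
    rfl

theorem lie (hS : HasSymbol S d₁ e₁ c₁) (hT : HasSymbol T d₂ e₂ c₂) :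
    HasSymbol ⁅S, T⁆ (d₁ + d₂) (e₁ + e₂)
      fun a b => c₂ a b * c₁ (a + d₂) (b + e₂) - c₁ a b * c₂ (a + d₁) (b + e₁) :=
  (hS.mul hT).sub ((hT.mul hS).congr (add_comm _ _) (add_comm _ _) fun _ _ => rfl)

theorem hasBidegree (hT : HasSymbol T d e c) : HasBidegree U T d e := by
  intro a b
  obtain ⟨hne, happly⟩ := hT a b
  change T (mon U a b) ∈ _
  rw [happly]
  by_cases h : c a b = 0
  · rw [h, zero_smul]; exact zero_mem _
  · obtain ⟨ha, hb⟩ := hne h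
    exact Submodule.smul_mem _ _ (Submodule.subset_span
      ⟨_, _, Int.toNat_of_nonneg ha, Int.toNat_of_nonneg hb, rfl⟩)

theorem eq_of_mem_diffOp (hS : HasSymbol S d e c₁) (hT : HasSymbol T d e c₂)
    (hS' : S ∈ diffOp U) (hT' : T ∈ diffOp U) (h : ∀ a b : ℕ, c₁ a b = c₂ a b) : S = T :=
  eq_of_mon hS' hT' fun a b _ => by rw [(hS a b).2, (hT a b).2, h]

end HasSymbol

theorem hasSymbol_dx : HasSymbol (dx U) (-1) 0 fun a _ => a := by
  intro a b
  refine ⟨fun h => ?_, ?_⟩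
  · have := Nat.cast_ne_zero.1 h
    omega
  · rw [dx_mon]
    congr 2
    omega

theorem hasSymbol_dy : HasSymbol (dy U) 0 (-1) fun _ b => b := by
  intro a b
  refine ⟨fun h => ?_, ?_⟩
  · have := Nat.cast_ne_zero.1 h
    omega
  · rw [dy_mon]
    congr 2
    omega

theorem hasSymbol_mulOp_mon (i j : ℕ) : HasSymbol (mulOp (mon U i j)) i j fun _ _ => 1 := by
  intro a b
  refine ⟨fun _ => by omega, ?_⟩
  rw [one_smul]
  exact (mon_mul_mon i j a b).trans (by congr 1 <;> omega)

theorem hasSymbol_mulOp_mon_mul_dx (i j : ℕ) :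
    HasSymbol (mulOp (mon U i j) * dx U) (i - 1) j fun a _ => a :=
  ((hasSymbol_mulOp_mon i j).mul hasSymbol_dx).congr rfl (add_zero _) fun a _ => mul_one (a : ℂ)

theorem hasSymbol_mulOp_mon_mul_dy (i j : ℕ) :
    HasSymbol (mulOp (mon U i j) * dy U) i (j - 1) fun _ b => b :=
  ((hasSymbol_mulOp_mon i j).mul hasSymbol_dy).congr (add_zero _) rfl fun _ b => mul_one (b : ℂ)

theorem prod_range_natCast_sub (a n : ℕ) :
    ∏ h ∈ range n, ((a : ℂ) - h) = (a.descFactorial n : ℂ) := by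
  rw [← descPochhammer_eval_eq_descFactorial, descPochhammer_eval_eq_prod_range]

theorem hasSymbol_dx_pow (n : ℕ) :
    HasSymbol (dx U ^ n) (-n) 0 fun a _ => ∏ h ∈ range n, (a - (h : ℂ)) :=
  (hasSymbol_dx.pow n).congr (by ring) (mul_zero _) fun a _ => by
    push_cast
    exact Finset.prod_congr rfl fun h _ => by ring

theorem hasSymbol_dy_pow (n : ℕ) :
    HasSymbol (dy U ^ n) 0 (-n) fun _ b => ∏ h ∈ range n, (b - (h : ℂ)) :=
  (hasSymbol_dy.pow n).congr (mul_zero _) (by ring) fun _ b => by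
    push_cast
    exact Finset.prod_congr rfl fun h _ => by ring

/-- The coefficients of the operator `∑ κ(a, i) x^i ∂_x^i` that is the projection onto `x^a` on
polynomials of bounded degree. -/
def projCoeff (a i : ℕ) : ℂ := (-1) ^ (i + a) * i.choose a / i.factorial

theorem projCoeff_of_lt {a i : ℕ} (h : i < a) : projCoeff a i = 0 := by
  rw [projCoeff, Nat.choose_eq_zero_of_lt h, Nat.cast_zero, mul_zero, zero_div]

theorem projCoeff_mul_descFactorial (a i c : ℕ) :
    projCoeff a i * c.descFactorial i = (-1) ^ (i + a) * (c.choose i * i.choose a : ℕ) := by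
  have factorial_ne_zero : (i.factorial : ℂ) ≠ 0 := Nat.cast_ne_zero.2 i.factorial_ne_zero
  rw [projCoeff, Nat.descFactorial_eq_factorial_mul_choose]
  push_cast
  field_simp

theorem sum_projCoeff_mul_descFactorial (a c : ℕ) :
    ∑ i ∈ range (c + 1), projCoeff a i * c.descFactorial i = if c = a then 1 else 0 := by
  rcases lt_or_ge c a with h | h
  · rw [if_neg h.ne]
    refine Finset.sum_eq_zero fun i hi => ?_
    rw [projCoeff_of_lt ((mem_range_succ_iff.1 hi).trans_lt h), zero_mul]
  · obtain ⟨n, rfl⟩ := Nat.exists_eq_add_of_le h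
    have alternating_sum :
        ∑ k ∈ range (n + 1), ((-1 : ℂ) ^ k * n.choose k) = if n = 0 then 1 else 0 := by
      exact_mod_cast Int.alternating_sum_range_choose (n := n)
    have sum_lower_eq_zero : ∑ i ∈ range a, projCoeff a i * (a + n).descFactorial i = 0 :=
      Finset.sum_eq_zero fun i hi => by rw [projCoeff_of_lt (mem_range.1 hi), zero_mul]
    have term_eq (k : ℕ) (_ : k ∈ range (n + 1)) :
        projCoeff a (a + k) * (a + n).descFactorial (a + k) =
          (a + n).choose a * ((-1) ^ k * n.choose k) := by
      rw [projCoeff_mul_descFactorial, Nat.choose_mul (Nat.le_add_right a k),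
        Nat.add_sub_cancel_left, Nat.add_sub_cancel_left, add_right_comm, pow_add,
        Even.neg_one_pow ⟨a, rfl⟩]
      push_cast
      ring
    rw [add_assoc, Finset.sum_range_add, sum_lower_eq_zero, zero_add,
      Finset.sum_congr rfl term_eq, ← Finset.mul_sum, alternating_sum]
    rcases eq_or_ne n 0 with rfl | hn
    · simp
    · simp [hn]

variable (U) in
/-- For a lower set `D`, the operator with exponents in `D` that maps `x^α` to `x^β` and kills the
other monomials with exponents in `D`. -/
def elemOp (D : Finset (ℕ × ℕ)) (α β : ℕ × ℕ) : Op U :=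
  ∑ γ ∈ D, (projCoeff α.1 γ.1 * projCoeff α.2 γ.2) •
    (mulOp (mon U (γ.1 - α.1 + β.1) (γ.2 - α.2 + β.2)) * dx U ^ γ.1 * dy U ^ γ.2)

theorem elemOp_mem_diffOpOn {D : Finset (ℕ × ℕ)} {P : ℕ → ℕ → Prop} (h : ∀ γ ∈ D, P γ.1 γ.2)
    (α β : ℕ × ℕ) : elemOp U D α β ∈ diffOpOn U P :=
  sum_mem fun γ hγ => Submodule.smul_mem _ _ (mulOp_mul_dx_pow_mul_dy_pow_mem _ (h γ hγ))

theorem hasSymbol_elemOp (D : Finset (ℕ × ℕ)) (α β : ℕ × ℕ) :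
    HasSymbol (elemOp U D α β) (β.1 - α.1) (β.2 - α.2) fun a b =>
      ∑ γ ∈ D, (projCoeff α.1 γ.1 * projCoeff α.2 γ.2) *
        ((∏ h ∈ range γ.1, (a - (h : ℂ))) * ∏ h ∈ range γ.2, (b - (h : ℂ))) := by
  refine HasSymbol.sum fun γ _ => ?_
  by_cases h : α ≤ γ
  · refine HasSymbol.smul ?_ _
    refine (((hasSymbol_mulOp_mon _ _).mul (hasSymbol_dx_pow γ.1)).mul
      (hasSymbol_dy_pow γ.2)).congr ?_ ?_ fun a b => ?_
    · have := h.1; omega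
    · have := h.2; omega
    · simp only [Int.cast_zero, add_zero, one_mul, mul_comm]
  · have projCoeff_mul_eq_zero : projCoeff α.1 γ.1 * projCoeff α.2 γ.2 = 0 := by
      rw [Prod.le_def, not_and_or, not_le, not_le] at h
      rcases h with h | h <;> simp [projCoeff_of_lt h]
    rw [projCoeff_mul_eq_zero, zero_smul]
    exact (HasSymbol.zero _ _).congr rfl rfl fun a b => (zero_mul _).symm

theorem sum_projCoeff_eq_ite {D : Finset (ℕ × ℕ)} (hD : IsLowerSet (D : Set (ℕ × ℕ)))
    (α : ℕ × ℕ) {γ : ℕ × ℕ} (hγ : γ ∈ D) :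
    ∑ δ ∈ D, (projCoeff α.1 δ.1 * projCoeff α.2 δ.2) *
      ((γ.1.descFactorial δ.1 : ℂ) * γ.2.descFactorial δ.2) = if γ = α then 1 else 0 := by
  have rectangle_subset : range (γ.1 + 1) ×ˢ range (γ.2 + 1) ⊆ D := fun δ hδ => by
    rw [mem_product, mem_range_succ_iff, mem_range_succ_iff] at hδ
    exact hD (Prod.le_def.2 hδ) hγ
  have eq_zero_of_notMem (δ : ℕ × ℕ) (hδ : δ ∉ range (γ.1 + 1) ×ˢ range (γ.2 + 1)) :
      (projCoeff α.1 δ.1 * projCoeff α.2 δ.2) *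
        ((γ.1.descFactorial δ.1 : ℂ) * γ.2.descFactorial δ.2) = 0 := by
    rw [mem_product, not_and_or, mem_range_succ_iff, mem_range_succ_iff, not_le, not_le] at hδ
    rcases hδ with h | h <;> simp [Nat.descFactorial_of_lt h]
  rw [← Finset.sum_subset rectangle_subset fun δ _ => eq_zero_of_notMem δ]
  simp only [mul_mul_mul_comm]
  rw [Finset.sum_product]
  dsimp only
  rw [← Finset.sum_mul_sum, sum_projCoeff_mul_descFactorial, sum_projCoeff_mul_descFactorial]
  simp only [Prod.ext_iff, mul_ite, mul_one, mul_zero, ← ite_and, and_comm]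

theorem elemOp_mon_of_mem {D : Finset (ℕ × ℕ)} (hD : IsLowerSet (D : Set (ℕ × ℕ)))
    (α β : ℕ × ℕ) {γ : ℕ × ℕ} (hγ : γ ∈ D) :
    elemOp U D α β (mon U γ.1 γ.2) = if γ = α then mon U β.1 β.2 else 0 := by
  rw [(hasSymbol_elemOp D α β γ.1 γ.2).2]
  simp only [prod_range_natCast_sub]
  rw [sum_projCoeff_eq_ite hD α hγ]
  split_ifs with h
  · subst h
    rw [one_smul]
    congr 1 <;> omega
  · exact zero_smul _ _

/-! ### Operators preserving the staircase module -/

/-- The exponents of the monomials that span the staircase module. -/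
def stairPts (r p q : ℕ) : Finset (ℕ × ℕ) :=
  {α ∈ range (p + 1) ×ˢ range (q + 1) | α.1 + r * α.2 ≤ p}

section StaircaseModule

variable {r p q : ℕ}

theorem mem_stairPts {α : ℕ × ℕ} : α ∈ stairPts r p q ↔ α.1 + r * α.2 ≤ p ∧ α.2 ≤ q := by
  rw [stairPts, mem_filter, mem_product, mem_range, mem_range]
  omega

theorem isLowerSet_stairPts : IsLowerSet (stairPts r p q : Set (ℕ × ℕ)) := by
  intro α β hβα hα
  rw [mem_coe, mem_stairPts] at hα ⊢
  exact ⟨(add_le_add hβα.1 (Nat.mul_le_mul_left r hβα.2)).trans hα.1, hβα.2.trans hα.2⟩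

theorem stair_eq_span_range :
    stair U r p q = Submodule.span ℂ
      (Set.range fun α : stairPts r p q => mon U α.1.1 α.1.2) := by
  refine congrArg (Submodule.span ℂ) (Set.ext fun g => ⟨?_, ?_⟩)
  · rintro ⟨i, j, hp, hq, rfl⟩
    exact ⟨⟨(i, j), mem_stairPts.2 ⟨hp, hq⟩⟩, rfl⟩
  · rintro ⟨⟨α, hα⟩, rfl⟩
    exact ⟨α.1, α.2, (mem_stairPts.1 hα).1, (mem_stairPts.1 hα).2, rfl⟩

theorem stair_le_iff {W : Submodule ℂ (Smooth U)} :
    stair U r p q ≤ W ↔ ∀ α ∈ stairPts r p q, mon U α.1 α.2 ∈ W := by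
  rw [stair_eq_span_range, Submodule.span_le, Set.range_subset_iff, Subtype.forall]
  rfl

theorem mon_mem_stair {α : ℕ × ℕ} (hα : α ∈ stairPts r p q) : mon U α.1 α.2 ∈ stair U r p q :=
  stair_le_iff.1 le_rfl α hα

theorem mem_preserving_of_mon {T : Op U} (hT : T ∈ diffOp U)
    (h : ∀ α ∈ stairPts r p q, T (mon U α.1 α.2) ∈ stair U r p q) : T ∈ preserving U r p q :=
  ⟨hT, stair_le_iff (W := (stair U r p q).comap T).2 h⟩

theorem mem_ker_restr_iff {T : preserving U r p q} :
    T ∈ LinearMap.ker (restr U r p q) ↔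
      ∀ α ∈ stairPts r p q, (T : Op U) (mon U α.1 α.2) = 0 := by
  refine Iff.trans ?_ (stair_le_iff (W := LinearMap.ker (T : Op U)))
  rw [LinearMap.mem_ker, LinearMap.ext_iff, Subtype.forall]
  exact forall₂_congr fun g hg => Subtype.ext_iff

theorem disjoint_distinguished :
    Disjoint (distinguished U r p q) (LinearMap.ker (restr U r p q)) := by
  refine Submodule.disjoint_def.2 fun T hT hker => Subtype.ext (eq_zero_of_mon hT fun a b hab => ?_)
  exact mem_ker_restr_iff.1 hker (a, b) (mem_stairPts.2 hab)

variable (U) in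
/-- The matrix unit of the staircase module that maps `x^α` to `x^β`, realized in the
distinguished complement; `x = (α, β)`. -/
def stairElem (r p q : ℕ) (x : stairPts r p q × stairPts r p q) : preserving U r p q :=
  ⟨elemOp U (stairPts r p q) x.1 x.2, mem_preserving_of_mon
    (elemOp_mem_diffOpOn (fun _ _ => trivial) _ _) fun γ hγ => by
      rw [elemOp_mon_of_mem isLowerSet_stairPts _ _ hγ]
      split_ifs
      · exact mon_mem_stair x.2.2
      · exact zero_mem _⟩

theorem stairElem_mem_distinguished (x : stairPts r p q × stairPts r p q) :
    stairElem U r p q x ∈ distinguished U r p q :=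
  elemOp_mem_diffOpOn (fun _ h => mem_stairPts.1 h) _ _

theorem stairElem_mon (x : stairPts r p q × stairPts r p q) (γ : stairPts r p q) :
    (stairElem U r p q x : Op U) (mon U γ.1.1 γ.1.2) =
      if γ = x.1 then mon U x.2.1.1 x.2.1.2 else 0 := by
  simp only [← Subtype.coe_inj]
  exact elemOp_mon_of_mem isLowerSet_stairPts _ _ γ.2

variable (U) in
/-- The coefficients of a polynomial function, extended to all smooth functions by some linear
map. -/
def coeffs : Smooth U →ₗ[ℂ] (ℕ × ℕ →₀ ℂ) :=
  (Finsupp.linearCombination ℂ fun α : ℕ × ℕ => mon U α.1 α.2).leftInverse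

theorem coeffs_mon (hU : (U : Set (ℂ × ℂ)).Nonempty) (a b : ℕ) :
    coeffs U (mon U a b) = Finsupp.single (a, b) 1 := by
  rw [coeffs]
  conv_lhs =>
    enter [2]
    rw [← one_smul ℂ (mon U a b),
      ← Finsupp.linearCombination_single ℂ (v := fun α : ℕ × ℕ => mon U α.1 α.2) 1 (a, b)]
  exact LinearMap.leftInverse_apply_of_inj
    (LinearMap.ker_eq_bot_of_injective (linearIndependent_mon hU)) _

theorem coeffs_apply_eq_zero_of_hasBidegree (hU : (U : Set (ℂ × ℂ)).Nonempty) {T : Op U} {d e : ℤ}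
    (hT : HasBidegree U T d e) (a b : ℕ) {β : ℕ × ℕ}
    (h : ¬((β.1 : ℤ) = a + d ∧ (β.2 : ℤ) = b + e)) : coeffs U (T (mon U a b)) β = 0 := by
  suffices hle : Submodule.span ℂ _ ≤ LinearMap.ker (Finsupp.lapply β ∘ₗ coeffs U) from hle (hT a b)
  refine Submodule.span_le.2 ?_
  rintro _ ⟨a', b', ha', hb', rfl⟩
  change coeffs U (mon U a' b') β = 0
  rw [coeffs_mon hU, Finsupp.single_eq_of_ne]
  rintro rfl
  exact h ⟨ha', hb'⟩

variable (U r p q) in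
/-- The matrix of an operator preserving the staircase module: its entry at `(α, β)` is the
coefficient of `x^β` in the image of `x^α`. -/
def matrixCoeff : preserving U r p q →ₗ[ℂ] (stairPts r p q × stairPts r p q → ℂ) :=
  LinearMap.pi fun x => Finsupp.lapply x.2.1 ∘ₗ coeffs U ∘ₗ
    LinearMap.applyₗ (mon U x.1.1.1 x.1.1.2) ∘ₗ (preserving U r p q).subtype

theorem matrixCoeff_apply (T : preserving U r p q) (x : stairPts r p q × stairPts r p q) :
    matrixCoeff U r p q T x = coeffs U ((T : Op U) (mon U x.1.1.1 x.1.1.2)) x.2 := rfl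

theorem matrixCoeff_stairElem (hU : (U : Set (ℂ × ℂ)).Nonempty)
    (x : stairPts r p q × stairPts r p q) :
    matrixCoeff U r p q (stairElem U r p q x) = Pi.single x 1 := by
  refine funext fun y => ?_
  simp only [matrixCoeff_apply, stairElem_mon, Pi.single_apply, Prod.ext_iff (y := x), ite_and]
  split_ifs with h₁ h₂
  · rw [h₂, coeffs_mon hU, Finsupp.single_eq_same]
  · rw [coeffs_mon hU]
    exact Finsupp.single_eq_of_ne fun h => h₂ (Subtype.ext h)
  · rw [map_zero, Finsupp.zero_apply]

theorem apply_mon_eq_sum_matrixCoeff (hU : (U : Set (ℂ × ℂ)).Nonempty) (T : preserving U r p q)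
    (γ : stairPts r p q) :
    (T : Op U) (mon U γ.1.1 γ.1.2) =
      ∑ β : stairPts r p q, matrixCoeff U r p q T (γ, β) • mon U β.1.1 β.1.2 := by
  have mem_stair := T.2.2 _ (mon_mem_stair (U := U) γ.2)
  rw [stair_eq_span_range, Submodule.mem_span_range_iff_exists_fun] at mem_stair
  obtain ⟨c, hc⟩ := mem_stair
  rw [← hc]
  refine Finset.sum_congr rfl fun β _ => congrArg (· • _) ?_
  rw [matrixCoeff_apply, ← hc]
  simp only [map_sum, map_smul, coeffs_mon hU, Finsupp.finsetSum_apply, Finsupp.smul_apply,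
    Prod.mk.eta, Finsupp.single_apply, Subtype.coe_inj, smul_eq_mul, mul_ite, mul_one, mul_zero,
    Finset.sum_ite_eq', mem_univ, if_true]

/-- The element of the distinguished complement with the same restriction to the staircase module
as `T`. -/
def stairPart (T : preserving U r p q) : preserving U r p q :=
  ∑ x, matrixCoeff U r p q T x • stairElem U r p q x

theorem stairPart_mem_distinguished (T : preserving U r p q) :
    stairPart T ∈ distinguished U r p q :=
  sum_mem fun x _ => Submodule.smul_mem _ _ (stairElem_mem_distinguished x)

theorem stairPart_mon (hU : (U : Set (ℂ × ℂ)).Nonempty) (T : preserving U r p q)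
    (γ : stairPts r p q) :
    (stairPart T : Op U) (mon U γ.1.1 γ.1.2) = (T : Op U) (mon U γ.1.1 γ.1.2) := by
  rw [apply_mon_eq_sum_matrixCoeff hU T, stairPart, Fintype.sum_prod_type]
  simp only [Submodule.coe_sum, Submodule.coe_smul, LinearMap.sum_apply, LinearMap.smul_apply,
    stairElem_mon, smul_ite, smul_zero]
  rw [Finset.sum_comm]
  simp only [Finset.sum_ite_eq, mem_univ, if_true]

theorem sub_stairPart_mem_ker (hU : (U : Set (ℂ × ℂ)).Nonempty) (T : preserving U r p q) :
    T - stairPart T ∈ LinearMap.ker (restr U r p q) := by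
  refine mem_ker_restr_iff.2 fun α hα => ?_
  rw [Submodule.coe_sub, LinearMap.sub_apply, stairPart_mon hU T ⟨α, hα⟩, sub_self]

theorem isCompl_distinguished (hU : (U : Set (ℂ × ℂ)).Nonempty) :
    IsCompl (distinguished U r p q) (LinearMap.ker (restr U r p q)) := by
  refine ⟨disjoint_distinguished, codisjoint_iff.2 (eq_top_iff.2 fun T _ => ?_)⟩
  rw [← add_sub_cancel (stairPart T) T]
  exact Submodule.add_mem_sup (stairPart_mem_distinguished T) (sub_stairPart_mem_ker hU T)

theorem projection_eq_stairPart (hU : (U : Set (ℂ × ℂ)).Nonempty)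
    (hc : IsCompl (distinguished U r p q) (LinearMap.ker (restr U r p q)))
    (T : preserving U r p q) : Submodule.projection _ _ hc T = stairPart T := by
  rw [← add_sub_cancel (stairPart T) T, map_add,
    (Submodule.projection_apply_eq_zero_iff hc).2 (sub_stairPart_mem_ker hU T), add_zero,
    add_sub_cancel]
  exact Submodule.projection_apply_left hc ⟨_, stairPart_mem_distinguished T⟩

theorem projection_mon (hU : (U : Set (ℂ × ℂ)).Nonempty)
    (hc : IsCompl (distinguished U r p q) (LinearMap.ker (restr U r p q)))
    (T : preserving U r p q) {γ : ℕ × ℕ} (hγ : γ ∈ stairPts r p q) :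
    (Submodule.projection _ _ hc T : Op U) (mon U γ.1 γ.2) = (T : Op U) (mon U γ.1 γ.2) := by
  rw [projection_eq_stairPart hU, stairPart_mon hU T ⟨γ, hγ⟩]

theorem linearIndependent_stairElem (hU : (U : Set (ℂ × ℂ)).Nonempty) :
    LinearIndependent ℂ (stairElem U r p q) := by
  refine LinearIndependent.of_comp (matrixCoeff U r p q) ?_
  convert Pi.linearIndependent_single_one (stairPts r p q × stairPts r p q) ℂ using 1
  exact funext fun x => matrixCoeff_stairElem hU x

variable (r p q) in
/-- The pairs `(α, β)` of exponents of the staircase module with `β₂ ≤ α₂`: they index the matrix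
units of nonpositive `y`-degree. -/
abbrev DownPairs : Type := {x : stairPts r p q × stairPts r p q // x.2.1.2 ≤ x.1.1.2}

theorem stairPart_mem_span (hU : (U : Set (ℂ × ℂ)).Nonempty) {T : preserving U r p q} {d e : ℤ}
    (he : e ≤ 0) (hT : HasBidegree U (T : Op U) d e) :
    stairPart T ∈ Submodule.span ℂ
      (Set.range fun x : DownPairs r p q => stairElem U r p q x.1) := by
  refine sum_mem fun x _ => ?_
  by_cases hx : x.2.1.2 ≤ x.1.1.2
  · exact Submodule.smul_mem _ _ (Submodule.subset_span ⟨⟨x, hx⟩, rfl⟩)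
  · rw [matrixCoeff_apply, coeffs_apply_eq_zero_of_hasBidegree hU hT _ _ (by omega), zero_smul]
    exact zero_mem _

theorem distinguishedDown_eq_span (hU : (U : Set (ℂ × ℂ)).Nonempty) :
    distinguishedDown U r p q = Submodule.span ℂ
      (Set.range fun x : DownPairs r p q => stairElem U r p q x.1) := by
  refine le_antisymm (Submodule.span_le.2 ?_) (Submodule.span_le.2 ?_)
  · rintro T ⟨hT, d, e, he, hTbideg⟩
    have eq_stairPart : T = stairPart T := sub_eq_zero.1 <|
      Submodule.disjoint_def.1 disjoint_distinguished _
        (sub_mem hT (stairPart_mem_distinguished T)) (sub_stairPart_mem_ker hU T)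
    rw [eq_stairPart]
    exact stairPart_mem_span hU he hTbideg
  · rintro _ ⟨x, rfl⟩
    exact Submodule.subset_span ⟨stairElem_mem_distinguished _, _, _,
      sub_nonpos.2 (Int.ofNat_le.2 x.2), (hasSymbol_elemOp _ _ _).hasBidegree⟩

theorem projection_mem_distinguishedDown (hU : (U : Set (ℂ × ℂ)).Nonempty)
    (hc : IsCompl (distinguished U r p q) (LinearMap.ker (restr U r p q)))
    {T : preserving U r p q} {d e : ℤ} (he : e ≤ 0) (hT : HasBidegree U (T : Op U) d e) :
    Submodule.projection _ _ hc T ∈ distinguishedDown U r p q := by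
  rw [projection_eq_stairPart hU hc, distinguishedDown_eq_span hU]
  exact stairPart_mem_span hU he hT

theorem finiteDimensional_distinguishedDown (hU : (U : Set (ℂ × ℂ)).Nonempty) :
    FiniteDimensional ℂ (distinguishedDown U r p q) := by
  rw [distinguishedDown_eq_span hU]
  exact FiniteDimensional.span_of_finite ℂ (Set.finite_range _)

theorem finrank_distinguishedDown (hU : (U : Set (ℂ × ℂ)).Nonempty) :
    Module.finrank ℂ (distinguishedDown U r p q) = Fintype.card (DownPairs r p q) := by
  rw [distinguishedDown_eq_span hU]
  exact finrank_span_eq_card ((linearIndependent_stairElem hU).comp _ Subtype.val_injective)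

theorem card_downPairs_eq_sum :
    Fintype.card (DownPairs r p q) = ∑ b ∈ range (q + 1), ∑ d ∈ range (b + 1),
      (p + 1 - r * b) * (p + 1 - r * d) := by
  let rows : Finset (Σ _ : (Σ _ : ℕ, ℕ), ℕ × ℕ) :=
    ((range (q + 1)).sigma fun b => range (b + 1)).sigma fun x =>
      range (p + 1 - r * x.1) ×ˢ range (p + 1 - r * x.2)
  have card_rows : #rows = ∑ b ∈ range (q + 1), ∑ d ∈ range (b + 1),
      (p + 1 - r * b) * (p + 1 - r * d) := by
    simp only [rows, Finset.card_sigma, Finset.sum_sigma, Finset.card_product, Finset.card_range]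
  have mem_rows (a b c d : ℕ) : ⟨⟨b, d⟩, (a, c)⟩ ∈ rows ↔
      (a, b) ∈ stairPts r p q ∧ (c, d) ∈ stairPts r p q ∧ d ≤ b := by
    simp only [rows, mem_sigma, mem_range, mem_product, mem_stairPts]
    omega
  rw [← card_rows, ← Fintype.card_coe]
  exact Fintype.card_congr
    { toFun := fun x => ⟨⟨⟨x.1.1.1.2, x.1.2.1.2⟩, (x.1.1.1.1, x.1.2.1.1)⟩,
        (mem_rows _ _ _ _).2 ⟨x.1.1.2, x.1.2.2, x.2⟩⟩
      invFun := fun y => ⟨(⟨(y.1.2.1, y.1.1.1), ((mem_rows _ _ _ _).1 y.2).1⟩,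
        ⟨(y.1.2.2, y.1.1.2), ((mem_rows _ _ _ _).1 y.2).2.1⟩), ((mem_rows _ _ _ _).1 y.2).2.2⟩
      left_inv := fun _ => rfl
      right_inv := fun _ => rfl }

theorem sum_mul_sum_sub_mul (P s : ℚ) (q : ℕ) :
    ∑ b ∈ range (q + 1), ∑ d ∈ range (b + 1), (P - s * b) * (P - s * d) =
      ((q : ℚ) + 1) * (q + 2) / 2 * (P * (P - q * s) + (q : ℚ) * s ^ 2 / 12 * (3 * q + 1)) := by
  have inner_sum (b : ℕ) :
      ∑ d ∈ range (b + 1), (P - s * (d : ℚ)) = (b + 1) * P - s * (b * (b + 1)) / 2 := by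
    induction b with
    | zero => simp
    | succ b ih => rw [Finset.sum_range_succ, ih]; push_cast; ring
  simp only [← Finset.mul_sum, inner_sum]
  induction q with
  | zero => simp
  | succ q ih => rw [Finset.sum_range_succ, ih]; push_cast; ring

theorem card_downPairs (h : q * r ≤ p) :
    (Fintype.card (DownPairs r p q) : ℚ) = ((q : ℚ) + 1) * (q + 2) / 2 *
      (((p : ℚ) + 1) * (p + 1 - q * r) + (q : ℚ) * r ^ 2 / 12 * (3 * q + 1)) := by
  rw [← sum_mul_sum_sub_mul, card_downPairs_eq_sum]
  push_cast
  have cast_sub {b : ℕ} (hb : b ≤ q) : ((p + 1 - r * b : ℕ) : ℚ) = (p : ℚ) + 1 - r * b := by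
    have := Nat.mul_le_mul_right r hb
    rw [Nat.cast_sub (by lia)]
    push_cast
    rfl
  refine Finset.sum_congr rfl fun b hb => Finset.sum_congr rfl fun d hd => ?_
  rw [mem_range_succ_iff] at hb hd
  rw [cast_sub hb, cast_sub (hd.trans hb)]

end StaircaseModule

/-! ### Polynomials vanishing on a translated lower set -/

section Interpolation

theorem mvPolynomial_eq_zero_of_eval_translate {σ R : Type*} [Finite σ] [CommRing R] [IsDomain R]
    [CharZero R] {D : Set (σ →₀ ℕ)} (hD : IsLowerSet D) (u : σ → R) {f : MvPolynomial σ R}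
    (hf : (f.support : Set (σ →₀ ℕ)) ⊆ D)
    (h : ∀ x ∈ D, MvPolynomial.eval (fun i => u i + (x i : R)) f = 0) : f = 0 := by
  classical
  by_contra hne
  obtain ⟨t, ht, htdeg⟩ := f.support.exists_mem_eq_sup (MvPolynomial.support_nonempty.2 hne)
    fun s => s.degree
  let grid (i : σ) : Finset R := (range (t i + 1)).image fun k : ℕ => u i + (k : R)
  have card_grid (i : σ) : #(grid i) = t i + 1 := by
    rw [Finset.card_image_of_injective _ fun k l hkl => Nat.cast_injective (add_left_cancel hkl),
      card_range]
  obtain ⟨s, hs, hs_eval⟩ := MvPolynomial.combinatorial_nullstellensatz_exists_eval_nonzero f t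
    (MvPolynomial.mem_support_iff.1 ht)
    (by rw [← htdeg, MvPolynomial.totalDegree]; rfl) grid fun i => by rw [card_grid]; omega
  have exists_nat (i : σ) : ∃ k ≤ t i, u i + (k : R) = s i := by
    obtain ⟨k, hk, hks⟩ := mem_image.1 (hs i)
    exact ⟨k, mem_range_succ_iff.1 hk, hks⟩
  choose x hx hxs using exists_nat
  refine hs_eval ?_
  rw [← funext hxs]
  exact h (Finsupp.equivFunOnFinite.symm x) (hD (fun i => hx i) (hf ht))

theorem eq_zero_of_sum_mul_pow_eq_zero {R : Type*} [CommRing R] [IsDomain R] [CharZero R]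
    {D : Set (ℕ × ℕ)} (hD : IsLowerSet D) (u v : R) {f : ℕ × ℕ →₀ R}
    (hf : (f.support : Set (ℕ × ℕ)) ⊆ D)
    (h : ∀ x ∈ D, f.sum (fun y c => c * ((u + (x.1 : R)) ^ y.1 * (v + (x.2 : R)) ^ y.2)) = 0) :
    f = 0 := by
  let e : ℕ × ℕ ≃ (Fin 2 →₀ ℕ) := (finTwoArrowEquiv ℕ).symm.trans Finsupp.equivFunOnFinite.symm
  let g : MvPolynomial (Fin 2) R := f.sum fun y c => MvPolynomial.monomial (e y) c
  have coeff_g (y : ℕ × ℕ) : g.coeff (e y) = f y := by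
    simp only [g, Finsupp.sum, MvPolynomial.coeff_sum, MvPolynomial.coeff_monomial,
      e.apply_eq_iff_eq, Finset.sum_ite_eq']
    exact ite_eq_left_iff.2 fun hy => (Finsupp.notMem_support_iff.1 hy).symm
  have g_eq_zero : g = 0 := by
    refine mvPolynomial_eq_zero_of_eval_translate (D := e.symm ⁻¹' D)
      (fun s t hts hs => hD (Prod.mk_le_mk.2 ⟨hts 0, hts 1⟩) hs) ![u, v] (fun s hs => ?_)
      fun s hs => ?_
    · rw [mem_coe, MvPolynomial.mem_support_iff, ← e.apply_symm_apply s, coeff_g] at hs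
      exact hf (mem_coe.2 (Finsupp.mem_support_iff.2 hs))
    · refine (map_finsuppSum _ _ _).trans (Eq.trans (Finsupp.sum_congr fun y _ => ?_) (h _ hs))
      rw [MvPolynomial.eval_monomial, Finsupp.prod_fintype _ _ fun i => pow_zero _,
        Fin.prod_univ_two]
      rfl
  ext y
  rw [← coeff_g, g_eq_zero, MvPolynomial.coeff_zero, Finsupp.zero_apply]

end Interpolation

/-! ### The generators and their monomials -/

variable {r p q k : ℕ}

theorem J_add_five (i : ℕ) : J U r p (i + 5) = mulOp (X U ^ i) * dy U := rfl

theorem mulOp_one : mulOp (1 : Smooth U) = 1 := map_one (Algebra.lmul ℂ (Smooth U))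

theorem J_five : J U r p 5 = dy U := by
  rw [J_add_five 0, pow_zero, mulOp_one, one_mul]

theorem hasSymbol_J_one : HasSymbol (J U r p 1) (-1) 0 fun a _ => a := hasSymbol_dx

theorem hasSymbol_J_two : HasSymbol (J U r p 2) 1 0 fun a b => a + r * b - p := by
  have J_two : J U r p 2 = mulOp (mon U 2 0) * dx U + (r : ℂ) • (mulOp (mon U 1 1) * dy U) -
      (p : ℂ) • mulOp (mon U 1 0) := by
    simp only [J, mon, pow_zero, pow_one, mul_one]
  rw [J_two]
  exact ((hasSymbol_mulOp_mon_mul_dx 2 0).add ((hasSymbol_mulOp_mon_mul_dy 1 1).smul r)).sub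
    ((hasSymbol_mulOp_mon 1 0).smul p) |>.congr rfl rfl fun a b => by rw [mul_one]

theorem hasSymbol_J_three : HasSymbol (J U r p 3) 0 0 fun a _ => a - p / 2 := by
  have J_three : J U r p 3 = mulOp (mon U 1 0) * dx U - ((p : ℂ) / 2) • 1 := by
    simp only [J, mon, pow_zero, pow_one, mul_one]
  rw [J_three]
  exact (hasSymbol_mulOp_mon_mul_dx 1 0).sub (HasSymbol.one.smul _) |>.congr rfl rfl
    fun a _ => by rw [mul_one]

theorem hasSymbol_J_four : HasSymbol (J U r p 4) 0 0 fun _ b => b := by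
  have J_four : J U r p 4 = mulOp (mon U 0 1) * dy U := by
    simp only [J, mon, pow_zero, pow_one, one_mul]
  rw [J_four]
  exact hasSymbol_mulOp_mon_mul_dy 0 1

theorem hasSymbol_J_add_five (i : ℕ) : HasSymbol (J U r p (i + 5)) i (-1) fun _ b => b := by
  rw [J_add_five, X_pow_eq_mon]
  exact (hasSymbol_mulOp_mon_mul_dy i 0).congr rfl rfl fun _ _ => rfl

theorem hasSymbol_J_two_pow (n : ℕ) :
    HasSymbol (J U r p 2 ^ n) n 0 fun a b => ∏ h ∈ range n, (a + r * b - p + (h : ℂ)) :=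
  (hasSymbol_J_two.pow n).congr (mul_one _) (mul_zero _) fun a b =>
    Finset.prod_congr rfl fun h _ => by push_cast; ring

theorem J_mem_diffOpLE {i : ℕ} (hi : 1 ≤ i) : J U r p i ∈ diffOpLE U 1 := by
  have mulOp_mul_dx_mem (f : Smooth U) : mulOp f * dx U ∈ diffOpLE U 1 := by
    simpa [diffOpLE] using mulOp_mul_dx_pow_mul_dy_pow_mem (P := fun i j => i + j ≤ 1) f
      (i := 1) (j := 0) le_rfl
  have mulOp_mul_dy_mem (f : Smooth U) : mulOp f * dy U ∈ diffOpLE U 1 := by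
    simpa [diffOpLE] using mulOp_mul_dx_pow_mul_dy_pow_mem (P := fun i j => i + j ≤ 1) f
      (i := 0) (j := 1) le_rfl
  have mulOp_mem (f : Smooth U) : mulOp f ∈ diffOpLE U 1 := by
    simpa [diffOpLE] using mulOp_mul_mem_diffOpOn f (one_mem_diffOpLE (U := U) 1)
  match i, hi with
  | 1, _ =>
    have := mulOp_mul_dx_mem 1
    rwa [mulOp_one, one_mul] at this
  | 2, _ =>
    exact sub_mem (add_mem (mulOp_mul_dx_mem _) (Submodule.smul_mem _ _ (mulOp_mul_dy_mem _)))
      (Submodule.smul_mem _ _ (mulOp_mem _))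
  | 3, _ => exact sub_mem (mulOp_mul_dx_mem _) (Submodule.smul_mem _ _ (one_mem_diffOpLE 1))
  | 4, _ => exact mulOp_mul_dy_mem _
  | i + 5, _ => exact mulOp_mul_dy_mem _

theorem J_mem_g24 {i : ℕ} (h1 : 1 ≤ i) (h2 : i ≤ r + 5) : J U r p i ∈ g24 U r p :=
  Submodule.subset_span ⟨i, h1, h2, rfl⟩

theorem g24_le_diffOpLE : g24 U r p ≤ diffOpLE U 1 :=
  Submodule.span_le.2 fun _ ⟨_, h1, _, h⟩ => h ▸ J_mem_diffOpLE h1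

theorem one_sup_g24_pow_le (k : ℕ) : (1 ⊔ g24 U r p) ^ k ≤ diffOpLE U k :=
  (pow_le_pow_left' (sup_le (Submodule.one_le.2 (one_mem_diffOpLE 1)) g24_le_diffOpLE) k).trans
    (diffOpLE_one_pow_le k)

theorem commute_mulOp_X_pow_dy (i : ℕ) : Commute (mulOp (X U ^ i)) (dy U) := by
  have leibniz := partialD_mul_mulOp (0, 1) (X U ^ i)
  have partialD_eq_zero : partialD U (0, 1) (X U ^ i) = 0 := by
    rw [partialD_pow, partialD_X, map_zero, mul_zero, smul_zero]
  rw [partialD_eq_zero, mulOp_eq_lmul 0, map_zero, zero_add] at leibniz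
  exact leibniz.symm

theorem J_add_five_pow (i j : ℕ) :
    J U r p (i + 5) ^ j = mulOp (X U ^ (i * j)) * dy U ^ j := by
  rw [J_add_five, (commute_mulOp_X_pow_dy i).mul_pow, mulOp_eq_lmul, ← map_pow, ← pow_mul,
    mulOp_eq_lmul]

theorem J_five_pow_mul_J_mul_J_pow (t i u : ℕ) :
    J U r p 5 ^ t * J U r p (i + 5) * J U r p (r + 5) ^ u =
      mulOp (X U ^ (i + r * u)) * dy U ^ (t + 1 + u) := by
  have commute_i := ((commute_mulOp_X_pow_dy (U := U) i).pow_right t).eq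
  have commute_ru := ((commute_mulOp_X_pow_dy (U := U) (r * u)).pow_right (t + 1)).eq
  rw [J_five, J_add_five_pow, J_add_five]
  calc dy U ^ t * (mulOp (X U ^ i) * dy U) * (mulOp (X U ^ (r * u)) * dy U ^ u)
      = mulOp (X U ^ i) * (dy U ^ (t + 1) * mulOp (X U ^ (r * u))) * dy U ^ u := by
        rw [← mul_assoc (dy U ^ t), ← commute_i, pow_succ]; simp only [mul_assoc]
    _ = mulOp (X U ^ (i + r * u)) * dy U ^ (t + 1 + u) := by
        rw [← commute_ru, pow_add (X U), ← mulOp_mul_mulOp, pow_add (dy U) (t + 1) u]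
        simp only [mul_assoc]

/-- The number of factors `J^1` in the leading factor of `x`-degree `d`. -/
def lowering (d : ℤ) : ℕ := (-d).toNat

/-- The number of factors `J^2` in the leading factor of bidegree `(d, -j)`. -/
def raising (r : ℕ) (d : ℤ) (j : ℕ) : ℕ := (d - (r * j : ℕ)).toNat

variable (U) in
/-- The leading factor of the monomials of bidegree `(d, -j)`: a product of `j` generators
`x^i ∂_y` with `0 ≤ i ≤ r`, multiplied by powers of `J^1` or `J^2` when `d` is out of the reach
`0 ≤ d ≤ r j` of such products. -/
def lead (r p : ℕ) (d : ℤ) (j : ℕ) : Op U :=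
  dx U ^ lowering d * J U r p 2 ^ raising r d j *
    (mulOp (X U ^ (min (max d 0) (r * j : ℕ)).toNat) * dy U ^ j)

/-- The symbol of `lead`. -/
def leadCoeff (r p : ℕ) (d : ℤ) (j : ℕ) (a b : ℂ) : ℂ :=
  (∏ h ∈ range j, (b - (h : ℂ))) * (∏ h ∈ range (raising r d j), (a + r * b - p + (h : ℂ))) *
    ∏ h ∈ range (lowering d), (a - (h : ℂ))

theorem hasSymbol_lead (d : ℤ) (j : ℕ) : HasSymbol (lead U r p d j) d (-j) (leadCoeff r p d j) := by
  rw [lead, X_pow_eq_mon]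
  refine (((hasSymbol_dx_pow _).mul (hasSymbol_J_two_pow _)).mul
    ((hasSymbol_mulOp_mon _ 0).mul (hasSymbol_dy_pow j))).congr ?_ (by simp) fun a b => ?_
  · simp only [lowering, raising]; omega
  · rw [leadCoeff, mul_one, mul_assoc]
    congr 2
    · refine Finset.prod_congr rfl fun h hh => ?_
      have toNat_eq : (min (max d 0) (r * j : ℕ)).toNat = r * j := by
        have := mem_range.1 hh
        simp only [raising] at this
        omega
      rw [toNat_eq]; push_cast; ring
    · refine Finset.prod_congr rfl fun h hh => ?_
      have hd : d < 0 := by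
        have := mem_range.1 hh
        simp only [lowering] at this
        omega
      have toNat_eq : (min (max d 0) (r * j : ℕ)).toNat = 0 := by omega
      have raising_eq : raising r d j = 0 := by simp only [raising]; omega
      rw [toNat_eq, raising_eq]; simp

theorem lead_neg (s j : ℕ) : lead U r p (-s) j = J U r p 1 ^ s * J U r p 5 ^ j := by
  have lowering_eq : lowering (-s) = s := by simp [lowering]
  have raising_eq : raising r (-s) j = 0 := by simp only [raising]; omega
  have toNat_eq : (min (max (-(s : ℤ)) 0) (r * j : ℕ)).toNat = 0 := by omega
  rw [lead, lowering_eq, raising_eq, toNat_eq, pow_zero, pow_zero, mul_one, J_five, mulOp_one,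
    one_mul]
  rfl

theorem lead_mul_add (s j : ℕ) :
    lead U r p ((r * j : ℕ) + s) j = J U r p 2 ^ s * J U r p (r + 5) ^ j := by
  have lowering_eq : lowering ((r * j : ℕ) + s) = 0 := by simp only [lowering]; omega
  have raising_eq : raising r ((r * j : ℕ) + s) j = s := by simp only [raising]; omega
  have toNat_eq : (min (max (((r * j : ℕ) : ℤ) + s) 0) (r * j : ℕ)).toNat = r * j := by omega
  rw [lead, lowering_eq, raising_eq, toNat_eq, J_add_five_pow, pow_zero, one_mul]

theorem lead_of_le {d j : ℕ} (h : d ≤ r * j) :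
    lead U r p d j = mulOp (X U ^ d) * dy U ^ j := by
  have lowering_eq : lowering d = 0 := by simp only [lowering]; omega
  have raising_eq : raising r d j = 0 := by simp only [raising]; omega
  have toNat_eq : (min (max (d : ℤ) 0) (r * j : ℕ)).toNat = d := by omega
  rw [lead, lowering_eq, raising_eq, toNat_eq, pow_zero, pow_zero, one_mul, one_mul]

theorem exists_lead_eq_J_pow_mul_J_pow {ε : ℕ} (hε : ε ≤ 1) (s j : ℕ) :
    ∃ d : ℤ, lowering d + raising r d j = s ∧
      J U r p (ε + 1) ^ s * J U r p (ε * r + 5) ^ j = lead U r p d j := by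
  obtain rfl | rfl := Nat.le_one_iff_eq_zero_or_eq_one.1 hε
  · refine ⟨-s, by simp only [lowering, raising]; omega, ?_⟩
    rw [lead_neg, zero_mul]
  · refine ⟨(r * j : ℕ) + s, by simp only [lowering, raising]; omega, ?_⟩
    rw [lead_mul_add, one_mul]

theorem exists_lead_eq_J_five_pow_mul_J_mul_J_pow {t i j : ℕ} (ht : t + 1 ≤ j) (hi : i ≤ r) :
    ∃ d : ℤ, lowering d + raising r d j = 0 ∧
      J U r p 5 ^ t * J U r p (i + 5) * J U r p (r + 5) ^ (j - t - 1) = lead U r p d j := by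
  obtain ⟨u, rfl⟩ := Nat.exists_eq_add_of_le ht
  have hle : i + r * u ≤ r * (t + 1 + u) := by
    rw [mul_add, mul_add]; nlinarith [Nat.zero_le (r * t)]
  refine ⟨(i + r * u : ℕ), by simp only [lowering, raising]; omega, ?_⟩
  rw [lead_of_le hle, Nat.sub_sub, Nat.add_sub_cancel_left, J_five_pow_mul_J_mul_J_pow]

theorem exists_J_five_pow_mul_J_mul_J_pow_eq_lead {d j : ℕ} (hd : 1 ≤ d) (hdj : d < r * j) :
    ∃ t i, t + 1 ≤ j ∧ 1 ≤ i ∧ i ≤ (if t = 0 then r - 1 else r) ∧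
      lead U r p d j = J U r p 5 ^ t * J U r p (i + 5) * J U r p (r + 5) ^ (j - t - 1) := by
  obtain ⟨n, rfl⟩ := Nat.exists_eq_add_of_le' hd
  have hr : 0 < r := Nat.pos_of_mul_pos_right (Nat.zero_lt_of_lt hdj)
  have mod_add_div := Nat.mod_add_div n r
  have div_lt : n / r < j := Nat.div_lt_of_lt_mul (by omega)
  have mod_lt := Nat.mod_lt n hr
  generalize n / r = u at mod_add_div div_lt
  generalize n % r = i at mod_add_div mod_lt
  refine ⟨j - 1 - u, i + 1, by omega, by omega, ?_, ?_⟩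
  · split_ifs with h
    · obtain rfl : j = u + 1 := by omega
      rw [mul_add] at hdj
      omega
    · omega
  · rw [lead_of_le hdj.le, show j - (j - 1 - u) - 1 = u by omega, J_five_pow_mul_J_mul_J_pow,
      show n + 1 = i + 1 + r * u by omega, show j - 1 - u + 1 + u = j by omega]

theorem lead_cases (r p : ℕ) (d : ℤ) (j : ℕ) :
    (∃ ε ≤ 1, lead U r p d j =
      J U r p (ε + 1) ^ (lowering d + raising r d j) * J U r p (ε * r + 5) ^ j) ∨
    (lowering d + raising r d j = 0 ∧ ∃ t i, t + 1 ≤ j ∧ 1 ≤ i ∧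
      i ≤ (if t = 0 then r - 1 else r) ∧ lead U r p d j =
        J U r p 5 ^ t * J U r p (i + 5) * J U r p (r + 5) ^ (j - t - 1)) := by
  rcases le_or_gt d 0 with hd | hd
  · obtain ⟨s, rfl⟩ : ∃ s : ℕ, d = -s := ⟨(-d).toNat, by omega⟩
    refine Or.inl ⟨0, by omega, ?_⟩
    have : lowering (-s) + raising r (-s) j = s := by simp only [lowering, raising]; omega
    rw [this, lead_neg, zero_mul]
  rcases le_or_gt ((r * j : ℕ) : ℤ) d with hdj | hdj
  · obtain ⟨s, rfl⟩ : ∃ s : ℕ, d = (r * j : ℕ) + s := ⟨(d - (r * j : ℕ)).toNat, by omega⟩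
    refine Or.inl ⟨1, by omega, ?_⟩
    have : lowering ((r * j : ℕ) + s) + raising r ((r * j : ℕ) + s) j = s := by
      simp only [lowering, raising]; omega
    rw [this, lead_mul_add, one_mul]
  · lift d to ℕ using hd.le
    exact Or.inr ⟨by simp only [lowering, raising]; omega,
      exists_J_five_pow_mul_J_mul_J_pow_eq_lead (by omega) (by omega)⟩

/-- The number of generators in the leading factor of bidegree `(α.1, -α.2)`. -/
def leadCount (r : ℕ) (α : ℤ × ℕ) : ℕ := lowering α.1 + raising r α.1 α.2 + α.2

/-- The number of generators in `basisMonomial U r p x`. -/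
def factorCount (r : ℕ) (x : (ℤ × ℕ) × ℕ × ℕ) : ℕ := leadCount r x.1 + (x.2.1 + x.2.2)

variable (U) in
/-- The monomials of both parts of the theorem, indexed by the bidegree `(x.1.1, -x.1.2)` and the
exponents `x.2` of `J^3` and `J^4`. -/
def basisMonomial (r p : ℕ) (x : (ℤ × ℕ) × ℕ × ℕ) : Op U :=
  lead U r p x.1.1 x.1.2 * J U r p 3 ^ x.2.1 * J U r p 4 ^ x.2.2

theorem hasSymbol_basisMonomial (x : (ℤ × ℕ) × ℕ × ℕ) :
    HasSymbol (basisMonomial U r p x) x.1.1 (-x.1.2)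
      fun a b => leadCoeff r p x.1.1 x.1.2 a b * ((a - p / 2) ^ x.2.1 * b ^ x.2.2) := by
  refine (((hasSymbol_lead _ _).mul (hasSymbol_J_three.pow x.2.1)).mul
    (hasSymbol_J_four.pow x.2.2)).congr (by simp) (by simp) fun a b => ?_
  simp only [Int.cast_zero, mul_zero, add_zero, Finset.prod_const, card_range]
  ring

/-- The indices of the monomials in part (a). -/
def effIndices (r p q : ℕ) : Set ((ℤ × ℕ) × ℕ × ℕ) :=
  {x | x.2.2 + x.1.2 ≤ q ∧
    x.2.1 + r * x.2.2 + (lowering x.1.1 + raising r x.1.1 x.1.2) + x.1.2 * r ≤ p}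

theorem effMonomials_eq_image (r p q : ℕ) :
    effMonomials U r p q = basisMonomial U r p '' effIndices r p q := by
  ext T
  constructor
  · rintro (⟨ε, s, j, n, m, hε, _, _, hq, hp, rfl⟩ | ⟨t, i, j, n, m, _, ht, _, hi, hq, hp, rfl⟩)
    · obtain ⟨d, hd, hlead⟩ := exists_lead_eq_J_pow_mul_J_pow (U := U) (r := r) (p := p) hε s j
      exact ⟨((d, j), n, m), ⟨hq, by dsimp only; omega⟩, by rw [hlead, basisMonomial]⟩
    · obtain ⟨d, hd, hlead⟩ := exists_lead_eq_J_five_pow_mul_J_mul_J_pow (U := U) (r := r)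
        (p := p) (i := i) ht (by split_ifs at hi <;> omega)
      exact ⟨((d, j), n, m), ⟨hq, by dsimp only; omega⟩, by rw [hlead, basisMonomial]⟩
  · rintro ⟨⟨⟨d, j⟩, n, m⟩, ⟨hq, hp⟩, rfl⟩
    dsimp only at hq hp
    rcases lead_cases (U := U) r p d j with ⟨ε, hε, hlead⟩ | ⟨h0, t, i, ht, hi, hir, hlead⟩
    · exact Or.inl ⟨ε, _, j, n, m, hε, by omega, by omega, hq, hp, by rw [basisMonomial, hlead]⟩
    · exact Or.inr ⟨t, i, j, n, m, by omega, ht, hi, hir, hq, by omega,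
        by rw [basisMonomial, hlead]⟩

theorem bigMonomials_eq_image (r p k : ℕ) :
    bigMonomials U r p k = basisMonomial U r p '' {x | factorCount r x ≤ k} := by
  ext T
  constructor
  · rintro (⟨ε, j, l, t, n, hε, hjl, hlt, htk, hn, rfl⟩ |
      ⟨s, i, l, t, n, hsl, hlt, htk, hn, _, hi, rfl⟩)
    · obtain ⟨d, hd, hlead⟩ :=
        exists_lead_eq_J_pow_mul_J_pow (U := U) (r := r) (p := p) hε (l - j) j
      refine ⟨((d, j), n, t - l - n), ?_, by rw [hlead, basisMonomial]⟩
      simp only [Set.mem_ofPred_eq, factorCount, leadCount]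
      omega
    · obtain ⟨d, hd, hlead⟩ := exists_lead_eq_J_five_pow_mul_J_mul_J_pow (U := U) (r := r)
        (p := p) (i := i) hsl (by split_ifs at hi <;> omega)
      refine ⟨((d, l), n, t - l - n), ?_, by rw [hlead, basisMonomial]⟩
      simp only [Set.mem_ofPred_eq, factorCount, leadCount]
      omega
  · rintro ⟨⟨⟨d, j⟩, n, m⟩, hk, rfl⟩
    simp only [Set.mem_ofPred_eq, factorCount, leadCount] at hk
    rcases lead_cases (U := U) r p d j with ⟨ε, hε, hlead⟩ | ⟨h0, t, i, ht, hi, hir, hlead⟩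
    · obtain ⟨s, hs⟩ : ∃ s, lowering d + raising r d j = s := ⟨_, rfl⟩
      refine Or.inl ⟨ε, j, s + j, s + j + n + m, n, hε, by omega, by omega, by omega, by omega, ?_⟩
      rw [basisMonomial, hlead, hs, Nat.add_sub_cancel, show s + j + n + m - (s + j) - n = m by
        omega]
    · refine Or.inr ⟨t, i, j, j + n + m, n, by omega, by omega, by omega, by omega, hi, hir, ?_⟩
      rw [basisMonomial, hlead, show j + n + m - j - n = m by omega]

/-! ### Symmetrized products -/

section Symmetrization

variable {A : Type} [Ring A] [Algebra ℂ A] (V : Submodule ℂ A)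

theorem symmProd_apply (n : ℕ) (v : Fin n → V) :
    symmProd V n v = ((n.factorial : ℂ)⁻¹) • ∑ σ : Equiv.Perm (Fin n),
      (List.ofFn fun i => (v (σ i) : A)).prod := by
  simp [symmProd, MultilinearMap.domDomCongr_apply]

theorem range_symmPow (n : ℕ) :
    LinearMap.range (symmPow V n) = Submodule.span ℂ (Set.range (symmProd V n)) := by
  rw [LinearMap.range_eq_map, ← SymmetricPower.span_tprod_eq_top, Submodule.map_span,
    ← Set.range_comp]
  exact congrArg _ (congrArg _ (funext (symmPow_tprod V n)))

theorem range_symmUpTo_eq_iSup (k : ℕ) :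
    LinearMap.range (symmUpTo V k) =
      ⨆ n : Fin (k + 1), Submodule.span ℂ (Set.range (symmProd V n)) := by
  have symmUpTo_comp_single (n : Fin (k + 1)) : symmUpTo V k ∘ₗ LinearMap.single ℂ
      (fun n : Fin (k + 1) => SymmetricPower ℂ (Fin n) V) n = symmPow V n := by
    ext x
    simp only [symmUpTo, LinearMap.comp_apply, LinearMap.sum_apply, LinearMap.proj_apply]
    rw [Finset.sum_eq_single n (fun m _ hm => by
      rw [LinearMap.single_apply, Pi.single_eq_of_ne hm, map_zero]) (by simp),
      LinearMap.single_apply, Pi.single_eq_same]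
  rw [LinearMap.range_eq_map, ← LinearMap.iSup_range_single, Submodule.map_iSup]
  refine iSup_congr fun n => ?_
  rw [← LinearMap.range_comp, symmUpTo_comp_single, range_symmPow]

theorem symmProd_mem_range_symmUpTo {n k : ℕ} (h : n ≤ k) (v : Fin n → V) :
    symmProd V n v ∈ LinearMap.range (symmUpTo V k) := by
  rw [range_symmUpTo_eq_iSup]
  exact Submodule.mem_iSup_of_mem (⟨n, Nat.lt_succ_of_le h⟩ : Fin (k + 1))
    (Submodule.subset_span ⟨v, rfl⟩)

theorem range_symmUpTo_le_iff {k : ℕ} {S : Submodule ℂ A} :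
    LinearMap.range (symmUpTo V k) ≤ S ↔ ∀ n ≤ k, ∀ v : Fin n → V, symmProd V n v ∈ S := by
  refine ⟨fun h n hn v => h (symmProd_mem_range_symmUpTo V hn v), fun h => ?_⟩
  rw [range_symmUpTo_eq_iSup]
  refine iSup_le fun n => Submodule.span_le.2 ?_
  rintro _ ⟨v, rfl⟩
  exact h n (Nat.lt_succ_iff.1 n.2) v

theorem one_sup_pow_mono : Monotone fun k : ℕ => (1 ⊔ V) ^ k :=
  fun _ _ h => pow_le_pow_right' le_sup_left h

theorem mul_mem_pow_add {W : Submodule ℂ A} {x y : A} {m n : ℕ} (hx : x ∈ W ^ m)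
    (hy : y ∈ W ^ n) : x * y ∈ W ^ (m + n) :=
  pow_add W m n ▸ Submodule.mul_mem_mul hx hy

variable {V} in
theorem one_sup_pow_le_of_mul_le {F : ℕ → Submodule ℂ A} (one_mem : 1 ∈ F 0) (mono : Monotone F)
    (mul_le : ∀ k, V * F k ≤ F (k + 1)) (k : ℕ) : (1 ⊔ V) ^ k ≤ F k := by
  induction k with
  | zero => rwa [pow_zero, Submodule.one_le]
  | succ k ih =>
    rw [pow_succ', Submodule.sup_mul, one_mul]
    exact sup_le (ih.trans (mono k.le_succ)) ((mul_le_mul' le_rfl ih).trans (mul_le k))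

theorem one_sup_pow_succ_le (k : ℕ) : (1 ⊔ V) ^ (k + 1) ≤ (1 ⊔ V) ^ k ⊔ V ^ (k + 1) := by
  induction k with
  | zero => simp
  | succ k ih =>
    calc (1 ⊔ V) ^ (k + 2) = (1 ⊔ V) ^ (k + 1) ⊔ V * (1 ⊔ V) ^ (k + 1) := by
          rw [pow_succ' _ (k + 1), Submodule.sup_mul, one_mul]
      _ ≤ (1 ⊔ V) ^ (k + 1) ⊔ V * ((1 ⊔ V) ^ k ⊔ V ^ (k + 1)) :=
          sup_le_sup_left (mul_le_mul' le_rfl ih) _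
      _ = (1 ⊔ V) ^ (k + 1) ⊔ V * (1 ⊔ V) ^ k ⊔ V ^ (k + 2) := by
          rw [Submodule.mul_sup, ← pow_succ', sup_assoc]
      _ ≤ (1 ⊔ V) ^ (k + 1) ⊔ V ^ (k + 2) := by
          refine sup_le_sup_right (sup_le le_rfl ?_) _
          rw [pow_succ']
          exact mul_le_mul' le_sup_right le_rfl

theorem list_prod_mem_pow {W : Submodule ℂ A} {L : List A} (hL : ∀ x ∈ L, x ∈ W) :
    L.prod ∈ W ^ L.length :=
  Submodule.pow_subset_pow W (Set.mem_pow.2 ⟨fun i => ⟨L.get i, hL _ (L.get_mem i)⟩,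
    congrArg List.prod (List.ofFn_get L)⟩)

theorem lie_mem_span {s : Set A} (hs : ∀ x ∈ s, ∀ y ∈ s, ⁅x, y⁆ ∈ Submodule.span ℂ s) :
    ∀ x ∈ Submodule.span ℂ s, ∀ y ∈ Submodule.span ℂ s, ⁅x, y⁆ ∈ Submodule.span ℂ s := by
  refine Submodule.map₂_le (f := LinearMap.mul ℂ A - (LinearMap.mul ℂ A).flip).1 ?_
  rw [Submodule.map₂_span_span, Submodule.span_le]
  rintro _ ⟨x, hx, y, hy, rfl⟩
  exact hs x hx y hy

variable {V}

/-- Swapping two neighbouring factors costs a commutator, which is a product with one factor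
less. -/
theorem list_prod_sub_mem_of_perm (hV : ∀ x ∈ V, ∀ y ∈ V, ⁅x, y⁆ ∈ V) {L L' : List A}
    (h : L.Perm L') (hL : ∀ x ∈ L, x ∈ V) : L.prod - L'.prod ∈ (1 ⊔ V) ^ (L.length - 1) := by
  have hW : V ≤ 1 ⊔ V := le_sup_right
  induction h with
  | nil => simp
  | @cons x l l' hl ih =>
    rw [List.prod_cons, List.prod_cons, ← mul_sub, List.length_cons, Nat.add_sub_cancel]
    have ih := ih fun y hy => hL y (by simp [hy])
    rcases Nat.eq_zero_or_pos l.length with h0 | h0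
    · obtain rfl := List.length_eq_zero_iff.1 h0
      simp [List.nil_perm.1 hl]
    · rw [← Nat.sub_add_cancel h0, pow_succ']
      exact Submodule.mul_mem_mul (hW (hL x (by simp))) ih
  | swap x y l =>
    have bracket_mem := hV y (hL y (by simp)) x (hL x (by simp))
    have prod_mem : l.prod ∈ (1 ⊔ V) ^ l.length :=
      list_prod_mem_pow fun z hz => hW (hL z (by simp [hz]))
    have prod_sub_prod : (y :: x :: l).prod - (x :: y :: l).prod = ⁅y, x⁆ * l.prod := by
      simp only [List.prod_cons, Ring.lie_def]; noncomm_ring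
    rw [prod_sub_prod, List.length_cons, List.length_cons, Nat.add_sub_cancel, pow_succ']
    exact Submodule.mul_mem_mul (hW bracket_mem) prod_mem
  | trans h₁ _ ih₁ ih₂ =>
    have hL₂ := ih₂ fun x hx => hL x (h₁.mem_iff.2 hx)
    rw [← h₁.length_eq] at hL₂
    simpa using add_mem (ih₁ hL) hL₂

theorem prod_ofFn_sub_symmProd_mem (hV : ∀ x ∈ V, ∀ y ∈ V, ⁅x, y⁆ ∈ V) {n : ℕ} (v : Fin n → V) :
    (List.ofFn fun i => (v i : A)).prod - symmProd V n v ∈ (1 ⊔ V) ^ (n - 1) := by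
  have average : (List.ofFn fun i => (v i : A)).prod - symmProd V n v =
      ((n.factorial : ℂ)⁻¹) • ∑ σ : Equiv.Perm (Fin n),
        ((List.ofFn fun i => (v i : A)).prod - (List.ofFn fun i => (v (σ i) : A)).prod) := by
    rw [symmProd_apply, Finset.sum_sub_distrib, smul_sub, Finset.sum_const, Finset.card_univ,
      Fintype.card_perm, Fintype.card_fin, ← Nat.cast_smul_eq_nsmul ℂ,
      inv_smul_smul₀ (Nat.cast_ne_zero.2 n.factorial_ne_zero)]
  rw [average]
  refine Submodule.smul_mem _ _ (sum_mem fun σ _ => ?_)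
  have := list_prod_sub_mem_of_perm hV (Equiv.Perm.ofFn_comp_perm σ fun i => (v i : A)).symm
    fun x hx => by
      obtain ⟨i, rfl⟩ := List.mem_ofFn.1 hx
      exact (v i).2
  rwa [List.length_ofFn] at this

theorem range_symmUpTo (hV : ∀ x ∈ V, ∀ y ∈ V, ⁅x, y⁆ ∈ V) (k : ℕ) :
    LinearMap.range (symmUpTo V k) = (1 ⊔ V) ^ k := by
  refine le_antisymm ((range_symmUpTo_le_iff V).2 fun n hn v => ?_) ?_
  · rw [symmProd_apply]
    refine one_sup_pow_mono V hn (Submodule.smul_mem _ _ (sum_mem fun σ _ => ?_))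
    exact Submodule.pow_subset_pow _ (Set.mem_pow.2
      ⟨fun i => ⟨(v (σ i) : A), Submodule.mem_sup_right (v (σ i)).2⟩, rfl⟩)
  · induction k with
    | zero =>
      rw [pow_zero, Submodule.one_le]
      simpa [symmProd_apply] using symmProd_mem_range_symmUpTo V le_rfl (Fin.elim0 : Fin 0 → V)
    | succ k ih =>
      have ih : (1 ⊔ V) ^ k ≤ LinearMap.range (symmUpTo V (k + 1)) :=
        ih.trans ((range_symmUpTo_le_iff V).2 fun n hn v =>
          symmProd_mem_range_symmUpTo V (by omega) v)
      refine (one_sup_pow_succ_le V k).trans (sup_le ih ?_)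
      rw [Submodule.pow_eq_span_pow_set, Submodule.span_le]
      intro a ha
      obtain ⟨v, rfl⟩ := Set.mem_pow.1 ha
      rw [SetLike.mem_coe, ← sub_add_cancel (List.prod _) (symmProd V (k + 1) v)]
      exact add_mem (ih (prod_ofFn_sub_symmProd_mem hV v)) (symmProd_mem_range_symmUpTo V le_rfl v)

end Symmetrization

/-! ### The image of `ρ` -/

theorem HasSymbol.lie_eq {S T R : Op U} {d₁ e₁ d₂ e₂ d e : ℤ} {c₁ c₂ c : ℂ → ℂ → ℂ}
    (hS : HasSymbol S d₁ e₁ c₁) (hT : HasSymbol T d₂ e₂ c₂) (hR : HasSymbol R d e c)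
    (hS' : S ∈ diffOpLE U 1) (hT' : T ∈ diffOpLE U 1) (hR' : R ∈ diffOpLE U 1)
    (hd : d₁ + d₂ = d) (he : e₁ + e₂ = e)
    (h : ∀ a b, c₂ a b * c₁ (a + d₂) (b + e₂) - c₁ a b * c₂ (a + d₁) (b + e₁) = c a b) :
    ⁅S, T⁆ = R := by
  have mul_mem {S T : Op U} (hS : S ∈ diffOpLE U 1) (hT : T ∈ diffOpLE U 1) : S * T ∈ diffOp U :=
    diffOpLE_le 2 (diffOpLE_mul_le 1 1 (Submodule.mul_mem_mul hS hT))
  exact ((hS.lie hT).congr hd he fun a b => h a b).eq_of_mem_diffOp hR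
    (sub_mem (mul_mem hS' hT') (mul_mem hT' hS')) (diffOpLE_le 1 hR') fun _ _ => rfl

theorem lie_J_one_J_two : ⁅J U r p 1, J U r p 2⁆ = (2 : ℂ) • J U r p 3 + (r : ℂ) • J U r p 4 := by
  refine hasSymbol_J_one.lie_eq hasSymbol_J_two
    ((hasSymbol_J_three.smul 2).add (hasSymbol_J_four.smul r)) (J_mem_diffOpLE le_rfl)
    (J_mem_diffOpLE (by omega)) ?_ rfl rfl fun a b => by push_cast; ring
  exact add_mem (Submodule.smul_mem _ _ (J_mem_diffOpLE (by omega)))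
    (Submodule.smul_mem _ _ (J_mem_diffOpLE (by omega)))

theorem lie_J_eq_smul {i j k : ℕ} (hi : 1 ≤ i) (hj : 1 ≤ j) (hk : 1 ≤ k) {d₁ e₁ d₂ e₂ d e : ℤ}
    {c₁ c₂ c : ℂ → ℂ → ℂ} (κ : ℂ) (hJi : HasSymbol (J U r p i) d₁ e₁ c₁)
    (hJj : HasSymbol (J U r p j) d₂ e₂ c₂) (hJk : HasSymbol (J U r p k) d e c)
    (hd : d₁ + d₂ = d) (he : e₁ + e₂ = e)
    (h : ∀ a b, c₂ a b * c₁ (a + d₂) (b + e₂) - c₁ a b * c₂ (a + d₁) (b + e₁) = κ * c a b) :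
    ⁅J U r p i, J U r p j⁆ = κ • J U r p k :=
  hJi.lie_eq hJj (hJk.smul κ) (J_mem_diffOpLE hi) (J_mem_diffOpLE hj)
    (Submodule.smul_mem _ _ (J_mem_diffOpLE hk)) hd he h

theorem lie_J_eq_zero {i j : ℕ} (hi : 1 ≤ i) (hj : 1 ≤ j) {d₁ e₁ d₂ e₂ : ℤ} {c₁ c₂ : ℂ → ℂ → ℂ}
    (hJi : HasSymbol (J U r p i) d₁ e₁ c₁) (hJj : HasSymbol (J U r p j) d₂ e₂ c₂)
    (h : ∀ a b, c₂ a b * c₁ (a + d₂) (b + e₂) - c₁ a b * c₂ (a + d₁) (b + e₁) = 0) :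
    ⁅J U r p i, J U r p j⁆ = 0 :=
  hJi.lie_eq hJj (HasSymbol.zero _ _) (J_mem_diffOpLE hi) (J_mem_diffOpLE hj) (zero_mem _) rfl rfl h

theorem lie_J_one_J_three : ⁅J U r p 1, J U r p 3⁆ = (1 : ℂ) • J U r p 1 :=
  lie_J_eq_smul le_rfl (by omega) le_rfl 1 hasSymbol_J_one hasSymbol_J_three hasSymbol_J_one rfl rfl
    fun a _ => by push_cast; ring

theorem lie_J_one_J_four : ⁅J U r p 1, J U r p 4⁆ = 0 :=
  lie_J_eq_zero le_rfl (by omega) hasSymbol_J_one hasSymbol_J_four fun a b => by push_cast; ring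

theorem lie_J_one_J_five : ⁅J U r p 1, J U r p 5⁆ = 0 :=
  lie_J_eq_zero le_rfl (by omega) hasSymbol_J_one (hasSymbol_J_add_five 0)
    fun a b => by push_cast; ring

theorem lie_J_one_J_add_six (l : ℕ) :
    ⁅J U r p 1, J U r p (l + 6)⁆ = (l + 1 : ℂ) • J U r p (l + 5) :=
  lie_J_eq_smul le_rfl (by omega) (by omega) _ hasSymbol_J_one (hasSymbol_J_add_five (l + 1))
    (hasSymbol_J_add_five l) (by push_cast; ring) rfl fun a b => by push_cast; ring

theorem lie_J_two_J_three : ⁅J U r p 2, J U r p 3⁆ = (-1 : ℂ) • J U r p 2 :=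
  lie_J_eq_smul (by omega) (by omega) (by omega) _ hasSymbol_J_two hasSymbol_J_three hasSymbol_J_two
    rfl rfl fun a b => by push_cast; ring

theorem lie_J_two_J_four : ⁅J U r p 2, J U r p 4⁆ = 0 :=
  lie_J_eq_zero (by omega) (by omega) hasSymbol_J_two hasSymbol_J_four
    fun a b => by push_cast; ring

theorem lie_J_two_J_add_five (l : ℕ) :
    ⁅J U r p 2, J U r p (l + 5)⁆ = (l - r : ℂ) • J U r p (l + 6) :=
  lie_J_eq_smul (by omega) (by omega) (by omega) _ hasSymbol_J_two (hasSymbol_J_add_five l)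
    (hasSymbol_J_add_five (l + 1)) (by push_cast; ring) rfl fun a b => by push_cast; ring

theorem lie_J_three_J_four : ⁅J U r p 3, J U r p 4⁆ = 0 :=
  lie_J_eq_zero (by omega) (by omega) hasSymbol_J_three hasSymbol_J_four
    fun a b => by push_cast; ring

theorem lie_J_three_J_add_five (l : ℕ) :
    ⁅J U r p 3, J U r p (l + 5)⁆ = (l : ℂ) • J U r p (l + 5) :=
  lie_J_eq_smul (by omega) (by omega) (by omega) _ hasSymbol_J_three (hasSymbol_J_add_five l)
    (hasSymbol_J_add_five l) (zero_add _) rfl fun a b => by push_cast; ring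

theorem lie_J_four_J_add_five (l : ℕ) :
    ⁅J U r p 4, J U r p (l + 5)⁆ = (-1 : ℂ) • J U r p (l + 5) :=
  lie_J_eq_smul (by omega) (by omega) (by omega) _ hasSymbol_J_four (hasSymbol_J_add_five l)
    (hasSymbol_J_add_five l) (zero_add _) rfl fun _ b => by push_cast; ring

theorem lie_J_add_five_J_add_five (i l : ℕ) : ⁅J U r p (i + 5), J U r p (l + 5)⁆ = 0 :=
  lie_J_eq_zero (by omega) (by omega) (hasSymbol_J_add_five i) (hasSymbol_J_add_five l)
    fun _ b => by push_cast; ring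

theorem lie_J_mem_g24 {i j : ℕ} (hi : 1 ≤ i) (hij : i < j) (hj : j ≤ r + 5) :
    ⁅J U r p i, J U r p j⁆ ∈ g24 U r p := by
  have smul_J_mem (κ : ℂ) {i : ℕ} (h1 : 1 ≤ i) (h2 : i ≤ r + 5) : κ • J U r p i ∈ g24 U r p :=
    Submodule.smul_mem _ κ (J_mem_g24 h1 h2)
  match i, j, hi, hij, hj with
  | 1, 2, _, _, _ =>
    rw [lie_J_one_J_two]
    exact add_mem (smul_J_mem _ (by omega) (by omega)) (smul_J_mem _ (by omega) (by omega))
  | 1, 3, _, _, _ => rw [lie_J_one_J_three]; exact smul_J_mem _ (by omega) (by omega)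
  | 1, 4, _, _, _ => rw [lie_J_one_J_four]; exact zero_mem _
  | 1, 5, _, _, _ => rw [lie_J_one_J_five]; exact zero_mem _
  | 1, l + 6, _, _, _ => rw [lie_J_one_J_add_six]; exact smul_J_mem _ (by omega) (by omega)
  | 2, 3, _, _, _ => rw [lie_J_two_J_three]; exact smul_J_mem _ (by omega) (by omega)
  | 2, 4, _, _, _ => rw [lie_J_two_J_four]; exact zero_mem _
  | 2, l + 5, _, _, hj =>
    rw [lie_J_two_J_add_five]
    rcases eq_or_ne l r with rfl | hl
    · rw [sub_self, zero_smul]; exact zero_mem _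
    · exact smul_J_mem _ (by omega) (by omega)
  | 3, 4, _, _, _ => rw [lie_J_three_J_four]; exact zero_mem _
  | 3, l + 5, _, _, _ => rw [lie_J_three_J_add_five]; exact smul_J_mem _ (by omega) (by omega)
  | 4, l + 5, _, _, _ => rw [lie_J_four_J_add_five]; exact smul_J_mem _ (by omega) (by omega)
  | i + 5, l + 5, _, _, _ => rw [lie_J_add_five_J_add_five]; exact zero_mem _

theorem lie_mem_g24 : ∀ S ∈ g24 U r p, ∀ T ∈ g24 U r p, ⁅S, T⁆ ∈ g24 U r p := by
  refine lie_mem_span ?_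
  rintro _ ⟨i, hi, hi', rfl⟩ _ ⟨j, hj, hj', rfl⟩
  rcases lt_trichotomy i j with h | rfl | h
  · exact lie_J_mem_g24 hi h hj'
  · rw [Ring.lie_def, sub_self]; exact zero_mem _
  · rw [Ring.lie_def, ← neg_sub]; exact neg_mem (lie_J_mem_g24 hj h hi')

theorem range_rho (k : ℕ) : LinearMap.range (rho U r p k) = (1 ⊔ g24 U r p) ^ k :=
  range_symmUpTo lie_mem_g24 k

/-- The polynomial functions of degree at most `N` in two variables `a`, `b`, spanned by the
products of powers of `a - p/2` and `b`, which are the symbols of `J^3` and `J^4`. -/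
def polyLE (p N : ℕ) : Submodule ℂ (ℂ → ℂ → ℂ) :=
  Submodule.span ℂ {f | ∃ n m : ℕ, n + m ≤ N ∧ f = fun a b : ℂ => (a - p / 2) ^ n * b ^ m}

theorem pow_mul_pow_mem_polyLE {n m N : ℕ} (h : n + m ≤ N) :
    (fun a b => (a - p / 2) ^ n * b ^ m : ℂ → ℂ → ℂ) ∈ polyLE p N :=
  Submodule.subset_span ⟨n, m, h, rfl⟩

theorem mul_mem_polyLE {M N : ℕ} {f g : ℂ → ℂ → ℂ} (hf : f ∈ polyLE p M) (hg : g ∈ polyLE p N) :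
    f * g ∈ polyLE p (M + N) := by
  refine (?_ : polyLE p M * polyLE p N ≤ polyLE p (M + N)) (Submodule.mul_mem_mul hf hg)
  rw [polyLE, polyLE, Submodule.span_mul_span, Submodule.span_le]
  rintro _ ⟨_, ⟨n, m, h, rfl⟩, _, ⟨n', m', h', rfl⟩, rfl⟩
  refine Submodule.subset_span ⟨n + n', m + m', by omega, ?_⟩
  funext a b
  simp only [Pi.mul_apply]
  ring

theorem one_mem_polyLE (N : ℕ) : (1 : ℂ → ℂ → ℂ) ∈ polyLE p N :=
  Submodule.subset_span ⟨0, 0, Nat.zero_le N, by funext a b; simp⟩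

theorem linear_mem_polyLE (α β γ : ℂ) : (fun a b => α * a + β * b + γ) ∈ polyLE p 1 := by
  have expand : (fun a b => α * a + β * b + γ) =
      α • (fun a b : ℂ => (a - p / 2) ^ 1 * b ^ 0) + β • (fun a b : ℂ => (a - p / 2) ^ 0 * b ^ 1) +
        (γ + α * (p / 2)) • (fun a b : ℂ => (a - p / 2) ^ 0 * b ^ 0) := by
    funext a b
    simp only [Pi.add_apply, Pi.smul_apply, smul_eq_mul]
    ring
  rw [expand]
  exact add_mem (add_mem (Submodule.smul_mem _ _ (pow_mul_pow_mem_polyLE (by norm_num)))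
    (Submodule.smul_mem _ _ (pow_mul_pow_mem_polyLE (by norm_num))))
    (Submodule.smul_mem _ _ (pow_mul_pow_mem_polyLE (by norm_num)))

theorem prod_mem_polyLE {ℓ : ℕ → ℂ → ℂ → ℂ} (hℓ : ∀ h, ℓ h ∈ polyLE p 1) (s : Finset ℕ) :
    ∏ h ∈ s, ℓ h ∈ polyLE p s.card := by
  induction s using Finset.cons_induction with
  | empty => exact one_mem_polyLE 0
  | cons x s hx ih =>
    rw [Finset.prod_cons, Finset.card_cons, add_comm]
    exact mul_mem_polyLE (hℓ x) ih

theorem exists_prod_range_eq_mul {s t : ℕ} (h : s ≤ t) {ℓ : ℕ → ℂ → ℂ → ℂ}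
    (hℓ : ∀ h, ℓ h ∈ polyLE p 1) : ∃ f ∈ polyLE p (t - s), ∀ a b,
      ∏ h ∈ range t, ℓ h a b = (∏ h ∈ range s, ℓ h a b) * f a b := by
  refine ⟨∏ h ∈ Ico s t, ℓ h, Nat.card_Ico s t ▸ prod_mem_polyLE hℓ _, fun a b => ?_⟩
  rw [Finset.prod_apply, Finset.prod_apply, Finset.prod_range_mul_prod_Ico _ h]

theorem exists_leadCoeff_mul_prod_Ico_eq_mul {d d' : ℤ} {j j' : ℕ} (hj : j ≤ j')
    (hl : lowering d' ≤ lowering d) (hr : raising r d' j' ≤ raising r d j) :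
    ∃ f ∈ polyLE p (raising r d j - raising r d' j' + (lowering d - lowering d')), ∀ a b,
      leadCoeff r p d j a b * ∏ h ∈ Ico j j', (b - (h : ℂ)) = leadCoeff r p d' j' a b * f a b := by
  obtain ⟨f, hf, raising_eq⟩ := exists_prod_range_eq_mul hr
    (ℓ := fun h a b => 1 * a + r * b + (h - p : ℂ)) fun h => linear_mem_polyLE (p := p) _ _ _
  obtain ⟨g, hg, lowering_eq⟩ := exists_prod_range_eq_mul hl
    (ℓ := fun h a b => 1 * a + 0 * b + -(h : ℂ)) fun h => linear_mem_polyLE (p := p) _ _ _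
  refine ⟨f * g, mul_mem_polyLE hf hg, fun a b => ?_⟩
  have raising_factor (h : ℕ) : a + r * b - p + (h : ℂ) = 1 * a + r * b + (h - p) := by ring
  have lowering_factor (h : ℕ) : a - (h : ℂ) = 1 * a + 0 * b + -h := by ring
  simp only [leadCoeff, raising_factor, lowering_factor, raising_eq, lowering_eq, Pi.mul_apply,
    ← Finset.prod_range_mul_prod_Ico _ hj]
  ring

theorem exists_leadCoeff_eq_mul {d d' : ℤ} {j : ℕ} (hl : lowering d' ≤ lowering d)
    (hr : raising r d' j ≤ raising r d j) :
    ∃ f ∈ polyLE p (raising r d j - raising r d' j + (lowering d - lowering d')), ∀ a b,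
      leadCoeff r p d j a b = leadCoeff r p d' j a b * f a b := by
  simpa using exists_leadCoeff_mul_prod_Ico_eq_mul (p := p) le_rfl hl hr

theorem J_pow_mem_one_sup_g24_pow {i : ℕ} (h1 : 1 ≤ i) (h2 : i ≤ r + 5) (s : ℕ) :
    J U r p i ^ s ∈ (1 ⊔ g24 U r p) ^ s :=
  Submodule.pow_mem_pow _ (Submodule.mem_sup_right (J_mem_g24 h1 h2)) s

theorem lead_mem_one_sup_g24_pow (d : ℤ) (j : ℕ) :
    lead U r p d j ∈ (1 ⊔ g24 U r p) ^ leadCount r (d, j) := by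
  rcases lead_cases (U := U) r p d j with ⟨ε, hε, hlead⟩ | ⟨h0, t, i, ht, -, hi, hlead⟩
  · have index_le : ε * r ≤ r := mul_le_of_le_one_left r.zero_le hε
    have le_index : 1 ≤ ε * r + 5 := by omega
    rw [hlead]
    exact mul_mem_pow_add
      (J_pow_mem_one_sup_g24_pow (Nat.le_add_left 1 ε) (by omega) _)
      (J_pow_mem_one_sup_g24_pow le_index (Nat.add_le_add_right index_le 5) j)
  · have hir : i ≤ r := by split_ifs at hi <;> omega
    have count_eq : leadCount r (d, j) = t + 1 + (j - t - 1) := by simp only [leadCount]; omega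
    rw [hlead, count_eq, ← pow_one (J U r p (i + 5))]
    exact mul_mem_pow_add (mul_mem_pow_add
      (J_pow_mem_one_sup_g24_pow (by omega) (by omega) t)
      (J_pow_mem_one_sup_g24_pow (by omega) (by omega) 1))
      (J_pow_mem_one_sup_g24_pow (by omega) le_rfl (j - t - 1))

theorem basisMonomial_mem_one_sup_g24_pow (x : (ℤ × ℕ) × ℕ × ℕ) :
    basisMonomial U r p x ∈ (1 ⊔ g24 U r p) ^ factorCount r x := by
  rw [factorCount, ← add_assoc]
  exact mul_mem_pow_add (mul_mem_pow_add (lead_mem_one_sup_g24_pow _ _)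
    (J_pow_mem_one_sup_g24_pow (by omega) (by omega) _))
    (J_pow_mem_one_sup_g24_pow (by omega) (by omega) _)

theorem basisMonomial_mem_diffOpLE (x : (ℤ × ℕ) × ℕ × ℕ) :
    basisMonomial U r p x ∈ diffOpLE U (factorCount r x) :=
  one_sup_g24_pow_le _ (basisMonomial_mem_one_sup_g24_pow x)

theorem basisMonomial_mem_diffOp (x : (ℤ × ℕ) × ℕ × ℕ) : basisMonomial U r p x ∈ diffOp U :=
  diffOpLE_le _ (basisMonomial_mem_diffOpLE x)

theorem basisMonomial_mem_bigMonomials {x : (ℤ × ℕ) × ℕ × ℕ} (hx : factorCount r x ≤ k) :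
    basisMonomial U r p x ∈ bigMonomials U r p k :=
  bigMonomials_eq_image r p k ▸ ⟨x, hx, rfl⟩

theorem span_bigMonomials_le (k : ℕ) :
    Submodule.span ℂ (bigMonomials U r p k) ≤ (1 ⊔ g24 U r p) ^ k := by
  rw [bigMonomials_eq_image, Submodule.span_le]
  rintro _ ⟨x, hx, rfl⟩
  exact one_sup_pow_mono _ hx (basisMonomial_mem_one_sup_g24_pow x)

theorem span_bigMonomials_mono : Monotone fun k => Submodule.span ℂ (bigMonomials U r p k) := by
  intro k l hkl
  simp only [bigMonomials_eq_image]
  exact Submodule.span_mono (Set.image_mono fun x hx => le_trans hx hkl)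

theorem mem_span_bigMonomials_of_hasSymbol {N : ℕ} {T : Op U} (hT : T ∈ diffOp U) {α : ℤ × ℕ}
    {f : ℂ → ℂ → ℂ} (hf : f ∈ polyLE p N)
    (hsymb : HasSymbol T α.1 (-α.2) fun a b => leadCoeff r p α.1 α.2 a b * f a b)
    (hk : leadCount r α + N ≤ k) : T ∈ Submodule.span ℂ (bigMonomials U r p k) := by
  obtain ⟨S, hS, hS'⟩ : ∃ S ∈ Submodule.span ℂ (bigMonomials U r p k),
      HasSymbol S α.1 (-α.2) fun a b => leadCoeff r p α.1 α.2 a b * f a b := by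
    clear hsymb
    induction hf using Submodule.span_induction with
    | mem f hf =>
      obtain ⟨n, m, h, rfl⟩ := hf
      exact ⟨basisMonomial U r p (α, n, m), Submodule.subset_span
        (basisMonomial_mem_bigMonomials ((Nat.add_le_add_left h _).trans hk)),
        hasSymbol_basisMonomial _⟩
    | zero => exact ⟨0, zero_mem _, (HasSymbol.zero _ _).congr rfl rfl fun a b => by simp⟩
    | add f g _ _ hf hg =>
      obtain ⟨S, hS, hS'⟩ := hf
      obtain ⟨T, hT, hT'⟩ := hg
      exact ⟨S + T, add_mem hS hT, (hS'.add hT').congr rfl rfl fun a b => by simp [mul_add]⟩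
    | smul c f _ hf =>
      obtain ⟨S, hS, hS'⟩ := hf
      exact ⟨c • S, Submodule.smul_mem _ c hS, (hS'.smul c).congr rfl rfl fun a b => by
        simp only [Pi.smul_apply, smul_eq_mul]; ring⟩
  have hS_diffOp : S ∈ diffOp U :=
    diffOpLE_le k (one_sup_g24_pow_le k (span_bigMonomials_le k hS))
  rwa [hsymb.eq_of_mem_diffOp hS' hT hS_diffOp fun _ _ => rfl]

theorem mul_basisMonomial_mem {S : Op U} {d e : ℤ} {c : ℂ → ℂ → ℂ} (hS : S ∈ diffOpLE U 1)
    (hc : HasSymbol S d e c) {x : (ℤ × ℕ) × ℕ × ℕ} {α : ℤ × ℕ} (hd : d + x.1.1 = α.1)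
    (he : e - x.1.2 = -α.2) {N : ℕ} {f : ℂ → ℂ → ℂ} (hf : f ∈ polyLE p N)
    (hcount : leadCount r α + N ≤ leadCount r x.1 + 1)
    (h : ∀ a b, leadCoeff r p x.1.1 x.1.2 a b * c (a + x.1.1) (b - x.1.2) =
      leadCoeff r p α.1 α.2 a b * f a b) :
    S * basisMonomial U r p x ∈ Submodule.span ℂ (bigMonomials U r p (factorCount r x + 1)) := by
  have mul_mem_diffOp : S * basisMonomial U r p x ∈ diffOp U :=
    diffOpLE_le _ (diffOpLE_mul_le 1 _ (Submodule.mul_mem_mul hS (basisMonomial_mem_diffOpLE x)))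
  refine mem_span_bigMonomials_of_hasSymbol mul_mem_diffOp (α := α)
    (mul_mem_polyLE hf (pow_mul_pow_mem_polyLE (n := x.2.1) (m := x.2.2) le_rfl))
    ((hc.mul (hasSymbol_basisMonomial x)).congr hd he fun a b => ?_)
    (by rw [factorCount]; omega)
  have hab := h a b
  push_cast
  simp only [Pi.mul_apply, ← sub_eq_add_neg]
  linear_combination ((a - p / 2 : ℂ) ^ x.2.1 * (b : ℂ) ^ x.2.2) * hab

theorem J_one_mul_basisMonomial_mem (x : (ℤ × ℕ) × ℕ × ℕ) : J U r p 1 * basisMonomial U r p x ∈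
    Submodule.span ℂ (bigMonomials U r p (factorCount r x + 1)) := by
  obtain ⟨⟨d, j⟩, n, m⟩ := x
  rcases le_or_gt d 0 with hd | hd
  · have lowering_eq : lowering (d - 1) = lowering d + 1 := by simp only [lowering]; omega
    have raising_eq : raising r (d - 1) j = raising r d j := by simp only [raising]; omega
    have cast_lowering : (lowering d : ℂ) = -d := by
      rw [← Int.cast_natCast, lowering, Int.toNat_of_nonneg (by omega), Int.cast_neg]
    refine mul_basisMonomial_mem (J_mem_diffOpLE le_rfl) hasSymbol_J_one (α := (d - 1, j))
      (by ring) (zero_sub _) (one_mem_polyLE 0) (by simp only [leadCount]; omega) fun a b => ?_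
    simp only [leadCoeff, lowering_eq, raising_eq, Finset.prod_range_succ, cast_lowering,
      Pi.one_apply]
    ring
  · obtain ⟨f, hf, hquot⟩ := exists_leadCoeff_eq_mul (r := r) (p := p) (d := d) (d' := d - 1)
      (j := j) (by simp only [lowering]; omega) (by simp only [raising]; omega)
    refine mul_basisMonomial_mem (J_mem_diffOpLE le_rfl) hasSymbol_J_one (α := (d - 1, j))
      (by ring) (zero_sub _) (mul_mem_polyLE hf (linear_mem_polyLE 1 0 d))
      (by simp only [leadCount, lowering, raising]; omega) fun a b => ?_
    simp only [hquot, Pi.mul_apply]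
    ring

theorem J_two_mul_basisMonomial_mem (x : (ℤ × ℕ) × ℕ × ℕ) : J U r p 2 * basisMonomial U r p x ∈
    Submodule.span ℂ (bigMonomials U r p (factorCount r x + 1)) := by
  obtain ⟨⟨d, j⟩, n, m⟩ := x
  rcases le_or_gt ((r * j : ℕ) : ℤ) d with hd | hd
  · have lowering_eq : lowering (d + 1) = lowering d := by simp only [lowering]; omega
    have raising_eq : raising r (d + 1) j = raising r d j + 1 := by simp only [raising]; omega
    have cast_raising : (raising r d j : ℂ) = d - r * j := by
      rw [← Int.cast_natCast, raising, Int.toNat_of_nonneg (by omega)]; push_cast; rfl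
    refine mul_basisMonomial_mem (J_mem_diffOpLE (by omega)) hasSymbol_J_two (α := (d + 1, j))
      (by ring) (zero_sub _) (one_mem_polyLE 0) (by simp only [leadCount]; omega) fun a b => ?_
    simp only [leadCoeff, lowering_eq, raising_eq, Finset.prod_range_succ, cast_raising,
      Pi.one_apply]
    ring
  · obtain ⟨f, hf, hquot⟩ := exists_leadCoeff_eq_mul (r := r) (p := p) (d := d) (d' := d + 1)
      (j := j) (by simp only [lowering]; omega) (by simp only [raising]; omega)
    refine mul_basisMonomial_mem (J_mem_diffOpLE (by omega)) hasSymbol_J_two (α := (d + 1, j))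
      (by ring) (zero_sub _) (mul_mem_polyLE hf (linear_mem_polyLE 1 r (d - r * j - p)))
      (by simp only [leadCount, lowering, raising]; omega) fun a b => ?_
    simp only [hquot, Pi.mul_apply]
    ring

theorem J_three_mul_basisMonomial_mem (x : (ℤ × ℕ) × ℕ × ℕ) : J U r p 3 * basisMonomial U r p x ∈
    Submodule.span ℂ (bigMonomials U r p (factorCount r x + 1)) :=
  mul_basisMonomial_mem (J_mem_diffOpLE (by omega)) hasSymbol_J_three (zero_add _) (zero_sub _)
    (linear_mem_polyLE 1 0 (x.1.1 - p / 2)) le_rfl fun a b => by ring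

theorem J_four_mul_basisMonomial_mem (x : (ℤ × ℕ) × ℕ × ℕ) : J U r p 4 * basisMonomial U r p x ∈
    Submodule.span ℂ (bigMonomials U r p (factorCount r x + 1)) :=
  mul_basisMonomial_mem (J_mem_diffOpLE (by omega)) hasSymbol_J_four (zero_add _) (zero_sub _)
    (linear_mem_polyLE 0 1 (-x.1.2)) le_rfl fun a b => by ring

theorem J_add_five_mul_basisMonomial_mem {i : ℕ} (hi : i ≤ r) (x : (ℤ × ℕ) × ℕ × ℕ) :
    J U r p (i + 5) * basisMonomial U r p x ∈
      Submodule.span ℂ (bigMonomials U r p (factorCount r x + 1)) := by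
  obtain ⟨⟨d, j⟩, n, m⟩ := x
  have lowering_le : lowering (i + d) ≤ lowering d := by simp only [lowering]; omega
  have raising_le : raising r (i + d) (j + 1) ≤ raising r d j := by
    simp only [raising, mul_add]; omega
  obtain ⟨f, hf, hquot⟩ :=
    exists_leadCoeff_mul_prod_Ico_eq_mul (p := p) (show j ≤ j + 1 by omega) lowering_le raising_le
  refine mul_basisMonomial_mem (J_mem_diffOpLE (by omega)) (hasSymbol_J_add_five i)
    (α := (i + d, j + 1)) rfl (by push_cast; ring) hf (by simp only [leadCount]; omega)
    fun a b => ?_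
  rw [← hquot, Nat.Ico_succ_singleton, Finset.prod_singleton]

theorem J_mul_basisMonomial_mem {i : ℕ} (h1 : 1 ≤ i) (h2 : i ≤ r + 5) (x : (ℤ × ℕ) × ℕ × ℕ) :
    J U r p i * basisMonomial U r p x ∈
      Submodule.span ℂ (bigMonomials U r p (factorCount r x + 1)) := by
  match i, h1, h2 with
  | 1, _, _ => exact J_one_mul_basisMonomial_mem x
  | 2, _, _ => exact J_two_mul_basisMonomial_mem x
  | 3, _, _ => exact J_three_mul_basisMonomial_mem x
  | 4, _, _ => exact J_four_mul_basisMonomial_mem x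
  | i + 5, _, h2 => exact J_add_five_mul_basisMonomial_mem (by omega) x

theorem g24_mul_span_bigMonomials_le (k : ℕ) :
    g24 U r p * Submodule.span ℂ (bigMonomials U r p k) ≤
      Submodule.span ℂ (bigMonomials U r p (k + 1)) := by
  rw [g24, Submodule.span_mul_span, Submodule.span_le, bigMonomials_eq_image]
  rintro _ ⟨_, ⟨i, h1, h2, rfl⟩, _, ⟨x, hx, rfl⟩, rfl⟩
  exact span_bigMonomials_mono (Nat.succ_le_succ hx) (J_mul_basisMonomial_mem h1 h2 x)

theorem one_mem_bigMonomials (k : ℕ) : 1 ∈ bigMonomials U r p k := by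
  refine Or.inl ⟨0, 0, 0, 0, 0, by omega, le_rfl, le_rfl, by omega, by omega, ?_⟩
  simp only [Nat.sub_zero, pow_zero, mul_one]

theorem span_bigMonomials (k : ℕ) :
    Submodule.span ℂ (bigMonomials U r p k) = LinearMap.range (rho U r p k) := by
  rw [range_rho]
  exact (span_bigMonomials_le k).antisymm (one_sup_pow_le_of_mul_le
    (Submodule.subset_span (one_mem_bigMonomials 0)) span_bigMonomials_mono
    g24_mul_span_bigMonomials_le k)

theorem range_rho_le (k : ℕ) : LinearMap.range (rho U r p k) ≤ diffOpLE U k :=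
  range_rho (U := U) k ▸ one_sup_g24_pow_le k

/-! ### Linear independence and part (a) -/

theorem HasSymbol.coeffs_apply (hU : (U : Set (ℂ × ℂ)).Nonempty) {T : Op U} {d e d' e' : ℤ}
    {c : ℂ → ℂ → ℂ} (hT : HasSymbol T d e c) {a b : ℕ} (ha : 0 ≤ a + d') (hb : 0 ≤ b + e') :
    coeffs U (T (mon U a b)) ((a + d').toNat, (b + e').toNat) =
      if (d, e) = (d', e') then c a b else 0 := by
  obtain ⟨nonneg, happly⟩ := hT a b
  split_ifs with h
  · obtain ⟨rfl, rfl⟩ := Prod.mk.inj h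
    rw [happly, map_smul, coeffs_mon hU, Finsupp.smul_apply, Finsupp.single_eq_same, smul_eq_mul,
      mul_one]
  · rw [happly, map_smul, coeffs_mon hU, Finsupp.smul_apply, smul_eq_mul, mul_eq_zero]
    refine or_iff_not_imp_left.2 fun hne => Finsupp.single_eq_of_ne fun heq => h ?_
    have := nonneg hne
    obtain ⟨h₁, h₂⟩ := Prod.mk.inj heq
    exact Prod.ext (by dsimp only; omega) (by dsimp only; omega)

theorem coeffs_linearCombination_basisMonomial_mon (hU : (U : Set (ℂ × ℂ)).Nonempty)
    (c : (ℤ × ℕ) × ℕ × ℕ →₀ ℂ) (α : ℤ × ℕ) {a b : ℕ} (ha : 0 ≤ a + α.1) (hb : 0 ≤ b + -(α.2 : ℤ)) :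
    coeffs U (Finsupp.linearCombination ℂ (basisMonomial U r p) c (mon U a b))
        ((a + α.1).toNat, (b + -(α.2 : ℤ)).toNat) =
      leadCoeff r p α.1 α.2 a b *
        (c.curry α).sum fun y t => t * ((a - p / 2 : ℂ) ^ y.1 * (b : ℂ) ^ y.2) := by
  let term (β : ℤ × ℕ) (y : ℕ × ℕ) (t : ℂ) : ℂ := if β = α then
    leadCoeff r p α.1 α.2 a b * (t * ((a - p / 2 : ℂ) ^ y.1 * (b : ℂ) ^ y.2)) else 0
  have bidegree_iff (β : ℤ × ℕ) : (β.1, -(β.2 : ℤ)) = (α.1, -(α.2 : ℤ)) ↔ β = α := by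
    simp only [neg_inj, Nat.cast_inj, Prod.ext_iff]
  calc _ = c.sum fun x t => term x.1 x.2 t := by
        rw [Finsupp.linearCombination_apply, Finsupp.sum, LinearMap.sum_apply, map_sum,
          Finsupp.finsetSum_apply]
        refine Finset.sum_congr rfl fun x _ => ?_
        rw [LinearMap.smul_apply, map_smul, Finsupp.smul_apply,
          (hasSymbol_basisMonomial x).coeffs_apply hU ha hb]
        simp only [bidegree_iff, term, smul_eq_mul, mul_ite, mul_zero]
        split_ifs with h
        · rw [h]; ring
        · rfl
    _ = c.curry.sum fun β f => f.sum (term β) := (Finsupp.sum_curry_index c term).symm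
    _ = (c.curry α).sum (term α) := Finsupp.sum_eq_single α
        (fun _ _ hβ => Finset.sum_eq_zero fun _ _ => if_neg hβ)
        fun _ => Finsupp.sum_zero_index
    _ = _ := by simp only [term, if_true, Finsupp.mul_sum]

theorem curry_eq_zero_of_linearCombination_mon_eq_zero (hU : (U : Set (ℂ × ℂ)).Nonempty)
    {c : (ℤ × ℕ) × ℕ × ℕ →₀ ℂ} {α : ℤ × ℕ} {D : Set (ℕ × ℕ)} (hD : IsLowerSet D)
    (hc : ((c.curry α).support : Set (ℕ × ℕ)) ⊆ D) {a₀ b₀ : ℕ}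
    (hlead : ∀ x ∈ D, leadCoeff r p α.1 α.2 (a₀ + x.1 : ℕ) (b₀ + x.2 : ℕ) ≠ 0)
    (h : ∀ x ∈ D,
      Finsupp.linearCombination ℂ (basisMonomial U r p) c (mon U (a₀ + x.1) (b₀ + x.2)) = 0) :
    c.curry α = 0 := by
  refine eq_zero_of_sum_mul_pow_eq_zero hD (a₀ - p / 2 : ℂ) b₀ hc fun x hx => ?_
  obtain ⟨ha, hb⟩ := (hasSymbol_lead (U := U) (r := r) (p := p) α.1 α.2 _ _).1 (hlead x hx)
  have key := coeffs_linearCombination_basisMonomial_mon (r := r) (p := p) hU c α ha hb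
  rw [h x hx, map_zero, Finsupp.zero_apply, zero_eq_mul, or_iff_right (hlead x hx)] at key
  rw [← key]
  refine Finsupp.sum_congr fun y _ => ?_
  push_cast
  ring

theorem leadCoeff_ne_zero {d : ℤ} {j a b : ℕ} (ha : lowering d ≤ a) (hb : j ≤ b)
    (h : ∀ i < raising r d j, a + r * b + i ≠ p) : leadCoeff r p d j a b ≠ 0 := by
  have prod_sub_ne_zero {s t : ℕ} (hst : s ≤ t) : ∏ i ∈ range s, ((t : ℂ) - i) ≠ 0 :=
    Finset.prod_ne_zero_iff.2 fun i hi => sub_ne_zero.2 fun e =>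
      ((mem_range.1 hi).trans_le hst).ne (Nat.cast_injective e).symm
  refine mul_ne_zero (mul_ne_zero (prod_sub_ne_zero hb) ?_) (prod_sub_ne_zero ha)
  refine Finset.prod_ne_zero_iff.2 fun i hi e => h i (mem_range.1 hi) ?_
  rw [← Nat.cast_inj (R := ℂ)]
  push_cast
  linear_combination e

theorem linearIndependent_basisMonomial (hU : (U : Set (ℂ × ℂ)).Nonempty) :
    LinearIndependent ℂ (basisMonomial U r p) := by
  refine linearIndependent_iff.2 fun c hc => Finsupp.ext fun x => ?_
  rw [← Prod.mk.eta (p := x), ← Finsupp.curry_apply,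
    curry_eq_zero_of_linearCombination_mon_eq_zero (r := r) (p := p) hU isLowerSet_univ
      (Set.subset_univ _) (a₀ := lowering x.1.1 + p + 1) (b₀ := x.1.2)
      (fun y _ => leadCoeff_ne_zero (by omega) (by omega) fun i _ => by omega)
      (fun y _ => by rw [hc, LinearMap.zero_apply])]
  rfl

theorem linearIndependent_bigMonomials (hU : (U : Set (ℂ × ℂ)).Nonempty) (k : ℕ) :
    LinearIndependent ℂ fun T : bigMonomials U r p k => (T : Op U) := by
  refine (linearIndependent_basisMonomial (r := r) (p := p) hU).linearIndepOn_id.mono ?_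
  rw [bigMonomials_eq_image]
  exact Set.image_subset_range _ _

theorem bounds_of_leadCoeff_ne_zero {d : ℤ} {j a b : ℕ} (hp : a + r * b ≤ p)
    (h : leadCoeff r p d j a b ≠ 0) :
    lowering d ≤ a ∧ j ≤ b ∧ a + r * b + raising r d j ≤ p := by
  obtain ⟨⟨hj, hraising⟩, hlowering⟩ : (_ ∧ _) ∧ _ := by
    simpa only [leadCoeff, mul_ne_zero_iff, Finset.prod_ne_zero_iff, mem_range] using h
  refine ⟨?_, ?_, ?_⟩
  · by_contra! hlt
    exact hlowering a hlt (sub_self _)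
  · by_contra! hlt
    exact hj b hlt (sub_self _)
  · by_contra! hlt
    refine hraising (p - (a + r * b)) (by omega) ?_
    rw [Nat.cast_sub hp]
    push_cast
    ring

theorem basisMonomial_mem_preserving (x : (ℤ × ℕ) × ℕ × ℕ) :
    basisMonomial U r p x ∈ preserving U r p q := by
  refine mem_preserving_of_mon (basisMonomial_mem_diffOp x) fun γ hγ => ?_
  obtain ⟨nonneg, happly⟩ := hasSymbol_basisMonomial (U := U) (r := r) (p := p) x γ.1 γ.2
  dsimp only at nonneg happly
  rw [happly]
  by_cases h0 : leadCoeff r p x.1.1 x.1.2 γ.1 γ.2 *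
      ((γ.1 - p / 2 : ℂ) ^ x.2.1 * (γ.2 : ℂ) ^ x.2.2) = 0
  · rw [h0, zero_smul]
    exact zero_mem _
  obtain ⟨ha, hb⟩ := nonneg h0
  obtain ⟨hp, hq⟩ := mem_stairPts.1 hγ
  obtain ⟨-, hj, hraising⟩ := bounds_of_leadCoeff_ne_zero hp (left_ne_zero_of_mul h0)
  obtain ⟨u, hu⟩ := Nat.exists_eq_add_of_le hj
  have toNat_eq : (γ.2 + -(x.1.2 : ℤ)).toNat = u := by omega
  rw [hu, mul_add] at hraising
  simp only [raising] at hraising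
  rw [toNat_eq]
  refine Submodule.smul_mem _ _ (mon_mem_stair (α := ((γ.1 + x.1.1).toNat, u))
    (mem_stairPts.2 ⟨?_, ?_⟩))
  · change (γ.1 + x.1.1).toNat + r * u ≤ p
    omega
  · change u ≤ q
    omega

variable (U r p q) in
/-- The values of an operator on the monomials of the staircase module. -/
def stairEval : Op U →ₗ[ℂ] (stairPts r p q → Smooth U) :=
  LinearMap.pi fun α => LinearMap.applyₗ (mon U α.1.1 α.1.2)

theorem stairEval_eq_zero_iff {T : Op U} :
    stairEval U r p q T = 0 ↔ ∀ α ∈ stairPts r p q, T (mon U α.1 α.2) = 0 :=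
  funext_iff.trans Subtype.forall

theorem linearIndepOn_effIndices (hU : (U : Set (ℂ × ℂ)).Nonempty) :
    LinearIndepOn ℂ (stairEval U r p q ∘ basisMonomial U r p) (effIndices r p q) := by
  refine linearIndepOn_iff.2 fun c hc h => Finsupp.ext fun x => ?_
  rw [← Finsupp.apply_linearCombination, stairEval_eq_zero_iff] at h
  have mem_effIndices {y : ℕ × ℕ} : y ∈ {y | (x.1, y) ∈ effIndices r p q} ↔ y.2 + x.1.2 ≤ q ∧
      y.1 + r * y.2 + (lowering x.1.1 + raising r x.1.1 x.1.2) + r * x.1.2 ≤ p := by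
    rw [mul_comm r x.1.2]; rfl
  rw [← Prod.mk.eta (p := x), ← Finsupp.curry_apply,
    curry_eq_zero_of_linearCombination_mon_eq_zero (r := r) (p := p)
      (D := {y | (x.1, y) ∈ effIndices r p q}) (a₀ := lowering x.1.1) (b₀ := x.1.2) hU ?_ ?_ ?_ ?_]
  · rfl
  · intro y z hzy hy
    rw [mem_effIndices] at hy ⊢
    have := Nat.mul_le_mul_left r hzy.2
    have := hzy.1
    have := hzy.2
    omega
  · intro y hy
    rw [mem_coe, Finsupp.mem_support_iff, Finsupp.curry_apply] at hy
    exact hc (Finsupp.mem_support_iff.2 hy)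
  · intro y hy
    rw [mem_effIndices] at hy
    refine leadCoeff_ne_zero (by omega) (by omega) fun i hi => ?_
    rw [mul_add]
    omega
  · intro y hy
    rw [mem_effIndices] at hy
    refine h (_, _) (mem_stairPts.2 ?_)
    dsimp only
    rw [mul_add]
    omega

theorem effMonomials_subset_preserving : ∀ T ∈ effMonomials U r p q, T ∈ preserving U r p q := by
  rw [effMonomials_eq_image]
  rintro _ ⟨x, -, rfl⟩
  exact basisMonomial_mem_preserving x

theorem linearIndependent_projection_effMonomials (hU : (U : Set (ℂ × ℂ)).Nonempty)
    (hM : ∀ T ∈ effMonomials U r p q, T ∈ preserving U r p q)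
    (hc : IsCompl (distinguished U r p q) (LinearMap.ker (restr U r p q))) :
    LinearIndependent ℂ fun T : effMonomials U r p q =>
      Submodule.projection _ _ hc ⟨T, hM T T.2⟩ := by
  refine LinearIndependent.of_comp (stairEval U r p q ∘ₗ (preserving U r p q).subtype) ?_
  have stairEval_projection : (stairEval U r p q ∘ₗ (preserving U r p q).subtype) ∘
      (fun T : effMonomials U r p q => Submodule.projection _ _ hc ⟨T, hM T T.2⟩) =
      fun T : effMonomials U r p q => stairEval U r p q T :=
    funext fun T => funext fun α => projection_mon hU hc ⟨T, hM T T.2⟩ α.2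
  rw [stairEval_projection]
  change LinearIndepOn ℂ (stairEval U r p q) (effMonomials U r p q)
  rw [effMonomials_eq_image]
  exact (linearIndepOn_effIndices hU).image_of_comp

variable (r p q) in
/-- The matrix units of nonpositive `y`-degree correspond to the monomials of part (a): in the
bidegree `(d, -j)` the matrix unit that maps `x^{lowering d + n} y^{j + m}` to a monomial
corresponds to the exponents `(n, m)` of `J^3` and `J^4`. -/
def downPairsEquivEffIndices : DownPairs r p q ≃ effIndices r p q where
  toFun x := ⟨((x.1.2.1.1 - x.1.1.1.1, x.1.1.1.2 - x.1.2.1.2),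
    (min x.1.1.1.1 x.1.2.1.1, x.1.2.1.2)), by
      obtain ⟨⟨⟨⟨a, b⟩, hα⟩, ⟨⟨c, e⟩, hβ⟩⟩, hle⟩ := x
      change e ≤ b at hle
      rw [mem_stairPts] at hα hβ
      obtain ⟨j, rfl⟩ := Nat.exists_eq_add_of_le hle
      simp only [effIndices, Set.mem_ofPred_eq, Nat.add_sub_cancel_left, lowering, raising,
        mul_comm j r, mul_add] at hα hβ ⊢
      omega⟩
  invFun x := ⟨(⟨(lowering x.1.1.1 + x.1.2.1, x.1.1.2 + x.1.2.2), by
      obtain ⟨⟨⟨d, j⟩, n, m⟩, hx⟩ := x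
      simp only [effIndices, Set.mem_ofPred_eq, mem_stairPts, mul_comm j r, mul_add] at hx ⊢
      omega⟩, ⟨(x.1.2.1 + x.1.1.1.toNat, x.1.2.2), by
      obtain ⟨⟨⟨d, j⟩, n, m⟩, hx⟩ := x
      simp only [effIndices, Set.mem_ofPred_eq, mem_stairPts, mul_comm j r, raising] at hx ⊢
      omega⟩), Nat.le_add_left _ _⟩
  left_inv x := by
    obtain ⟨⟨⟨⟨a, b⟩, hα⟩, ⟨⟨c, e⟩, hβ⟩⟩, hle⟩ := x
    change e ≤ b at hle
    simp only [lowering, Subtype.mk.injEq, Prod.mk.injEq, and_true]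
    omega
  right_inv x := by
    obtain ⟨⟨⟨d, j⟩, n, m⟩, hx⟩ := x
    simp only [lowering, Subtype.mk.injEq, Prod.mk.injEq, and_true]
    omega

theorem span_projection_effMonomials (hU : (U : Set (ℂ × ℂ)).Nonempty)
    (hM : ∀ T ∈ effMonomials U r p q, T ∈ preserving U r p q)
    (hc : IsCompl (distinguished U r p q) (LinearMap.ker (restr U r p q))) :
    Submodule.span ℂ (Set.range fun T : effMonomials U r p q =>
      Submodule.projection _ _ hc ⟨T, hM T T.2⟩) = distinguishedDown U r p q := by
  have := finiteDimensional_distinguishedDown (r := r) (p := p) (q := q) hU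
  let e : DownPairs r p q ≃ effMonomials U r p q := (downPairsEquivEffIndices r p q).trans
    ((Equiv.Set.image _ _ (linearIndependent_basisMonomial hU).injective).trans
      (Equiv.setCongr (effMonomials_eq_image r p q).symm))
  let : Fintype (effMonomials U r p q) := Fintype.ofEquiv _ e
  refine Submodule.eq_of_le_of_finrank_eq (Submodule.span_le.2 ?_) ?_
  · rintro _ ⟨T, rfl⟩
    obtain ⟨x, -, hx⟩ := (effMonomials_eq_image (U := U) r p q).subset T.2
    exact projection_mem_distinguishedDown hU hc (Int.neg_nonpos_of_nonneg (Int.natCast_nonneg _))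
      (hx ▸ (hasSymbol_basisMonomial x).hasBidegree)
  · rw [finrank_distinguishedDown hU, Fintype.card_congr e]
    exact finrank_span_eq_card (linearIndependent_projection_effMonomials hU hM hc)

/-! ### Orders and counting -/

section Order

open Polynomial

theorem descFactorial_mul_pow_sub {x : ℂ} (hx : x ≠ 0) (a i : ℕ) :
    (a.descFactorial i : ℂ) * x ^ (a - i) =
      (descPochhammer ℂ i).eval (a : ℂ) * (x ^ i)⁻¹ * x ^ a := by
  rw [descPochhammer_eval_eq_descFactorial]
  rcases lt_or_ge a i with h | h
  · rw [Nat.descFactorial_of_lt h, Nat.cast_zero, zero_mul, zero_mul, zero_mul]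
  · rw [pow_sub₀ x hx h]
    ring

theorem exists_polynomial_diagonal {l : ℕ} {T : Op U} (hT : T ∈ diffOpLE U l) {z : U}
    (h₁ : (z : ℂ × ℂ).1 ≠ 0) (h₂ : (z : ℂ × ℂ).2 ≠ 0) :
    ∃ Q : ℂ[X], Q.natDegree ≤ l ∧
      ∀ a : ℕ, (T (mon U a a)).fn z = Q.eval (a : ℂ) * (mon U a a).fn z := by
  induction hT using Submodule.span_induction with
  | mem T h =>
    obtain ⟨f, i, j, hij, rfl⟩ := h
    refine ⟨C (f.fn z * ((z : ℂ × ℂ).1 ^ i)⁻¹ * ((z : ℂ × ℂ).2 ^ j)⁻¹) *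
      (descPochhammer ℂ i * descPochhammer ℂ j), ?_, fun a => ?_⟩
    · refine (natDegree_C_mul_le _ _).trans (natDegree_mul_le.trans ?_)
      rwa [descPochhammer_natDegree, descPochhammer_natDegree]
    · rw [mulOp_mul_dx_pow_mul_dy_pow_mon, fn_smul, fn_mul, fn_mon, fn_mon, eval_mul, eval_mul,
        eval_C]
      linear_combination f.fn z * ((a.descFactorial j : ℂ) * (z : ℂ × ℂ).2 ^ (a - j)) *
        descFactorial_mul_pow_sub h₁ a i + f.fn z * ((descPochhammer ℂ i).eval (a : ℂ) *
          ((z : ℂ × ℂ).1 ^ i)⁻¹ * (z : ℂ × ℂ).1 ^ a) * descFactorial_mul_pow_sub h₂ a j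
  | zero => exact ⟨0, by simp, fun a => by simp⟩
  | add S T _ _ hS hT =>
    obtain ⟨Q, hQ, hQ'⟩ := hS
    obtain ⟨R, hR, hR'⟩ := hT
    refine ⟨Q + R, natDegree_add_le_of_degree_le hQ hR, fun a => ?_⟩
    rw [LinearMap.add_apply, fn_add, hQ', hR', eval_add, add_mul]
  | smul c T _ hT =>
    obtain ⟨Q, hQ, hQ'⟩ := hT
    refine ⟨c • Q, (natDegree_smul_le _ _).trans hQ, fun a => ?_⟩
    rw [LinearMap.smul_apply, fn_smul, hQ', eval_smul, smul_eq_mul, mul_assoc]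

theorem HasSymbol.fn_apply_mon {T : Op U} {d e : ℤ} {c : ℂ → ℂ → ℂ} (hT : HasSymbol T d e c)
    {z : U} (h₁ : (z : ℂ × ℂ).1 ≠ 0) (h₂ : (z : ℂ × ℂ).2 ≠ 0) (a b : ℕ) :
    (T (mon U a b)).fn z =
      (z : ℂ × ℂ).1 ^ d * (z : ℂ × ℂ).2 ^ e * c a b * (mon U a b).fn z := by
  obtain ⟨nonneg, happly⟩ := hT a b
  rw [happly, fn_smul, fn_mon, fn_mon]
  by_cases h0 : c a b = 0
  · rw [h0, zero_mul, mul_zero, zero_mul]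
  obtain ⟨ha, hb⟩ := nonneg h0
  have pow_toNat {w : ℂ} (hw : w ≠ 0) {n : ℕ} {m : ℤ} (h : 0 ≤ n + m) :
      w ^ (n + m).toNat = w ^ n * w ^ m := by
    rw [← zpow_natCast, Int.toNat_of_nonneg h, zpow_add₀ hw, zpow_natCast]
  rw [pow_toNat h₁ ha, pow_toNat h₂ hb]
  ring

theorem HasSymbol.natDegree_le (hU : (U : Set (ℂ × ℂ)).Nonempty) {T : Op U} {d e : ℤ}
    {c : ℂ → ℂ → ℂ} (hT : HasSymbol T d e c) {l : ℕ} (hl : T ∈ diffOpLE U l) {R : ℂ[X]}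
    (hR : ∀ t, R.eval t = c t t) : R.natDegree ≤ l := by
  obtain ⟨z, h₁, h₂⟩ := exists_mem_ne_zero hU
  obtain ⟨Q, hQ, hQeval⟩ := exists_polynomial_diagonal hl h₁ h₂
  have scale_ne_zero : (z : ℂ × ℂ).1 ^ d * (z : ℂ × ℂ).2 ^ e ≠ 0 :=
    mul_ne_zero (zpow_ne_zero _ h₁) (zpow_ne_zero _ h₂)
  have Q_eq : Q = C ((z : ℂ × ℂ).1 ^ d * (z : ℂ × ℂ).2 ^ e) * R := by
    refine eq_of_infinite_eval_eq _ _ ((Set.infinite_range_of_injective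
      (Nat.cast_injective (R := ℂ))).mono ?_)
    rintro _ ⟨a, rfl⟩
    have fn_ne_zero : (mon U a a).fn z ≠ 0 := by
      rw [fn_mon]
      exact mul_ne_zero (pow_ne_zero _ h₁) (pow_ne_zero _ h₂)
    refine mul_right_cancel₀ fn_ne_zero ?_
    rw [← hQeval, hT.fn_apply_mon h₁ h₂, eval_mul, eval_C, hR]
  rwa [Q_eq, natDegree_C_mul scale_ne_zero] at hQ

/-- The symbol of `basisMonomial U r p x` on the diagonal `a = b`, as a polynomial. -/
def symbolDiagonal (r p : ℕ) (x : (ℤ × ℕ) × ℕ × ℕ) : ℂ[X] :=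
  (∏ h ∈ range x.1.2, (Polynomial.X - C (h : ℂ))) *
    (∏ h ∈ range (raising r x.1.1 x.1.2), (C (1 + r : ℂ) * Polynomial.X + C (h - p : ℂ))) *
    (∏ h ∈ range (lowering x.1.1), (Polynomial.X - C (h : ℂ))) *
    ((Polynomial.X - C (p / 2 : ℂ)) ^ x.2.1 * Polynomial.X ^ x.2.2)

theorem eval_symbolDiagonal (r p : ℕ) (x : (ℤ × ℕ) × ℕ × ℕ) (t : ℂ) :
    (symbolDiagonal r p x).eval t =
      leadCoeff r p x.1.1 x.1.2 t t * ((t - p / 2) ^ x.2.1 * t ^ x.2.2) := by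
  simp only [symbolDiagonal, leadCoeff, eval_mul, eval_prod, eval_sub, eval_add, eval_X, eval_C,
    eval_pow]
  congr 3
  exact Finset.prod_congr rfl fun h _ => by ring

theorem natDegree_symbolDiagonal (r p : ℕ) (x : (ℤ × ℕ) × ℕ × ℕ) :
    (symbolDiagonal r p x).natDegree = factorCount r x := by
  have one_add_ne_zero : (1 + r : ℂ) ≠ 0 := by
    rw [add_comm]
    exact Nat.cast_add_one_ne_zero r
  refine natDegree_eq_of_degree_eq_some ?_
  simp only [symbolDiagonal, degree_mul, degree_prod, degree_pow, degree_X_sub_C, degree_X,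
    degree_linear one_add_ne_zero, Finset.sum_const, card_range, nsmul_one, factorCount, leadCount]
  norm_cast
  omega

theorem hasOrder_basisMonomial_iff (hU : (U : Set (ℂ × ℂ)).Nonempty) (x : (ℤ × ℕ) × ℕ × ℕ) :
    HasOrder U (basisMonomial U r p x) k ↔ factorCount r x = k := by
  have mem := basisMonomial_mem_diffOpLE (U := U) (r := r) (p := p) x
  have factorCount_le {l : ℕ} (hl : basisMonomial U r p x ∈ diffOpLE U l) : factorCount r x ≤ l :=
    natDegree_symbolDiagonal r p x ▸
      (hasSymbol_basisMonomial x).natDegree_le hU hl (eval_symbolDiagonal r p x)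
  constructor
  · rintro ⟨hk, hlt⟩
    exact le_antisymm (factorCount_le hk) (not_lt.1 fun h => hlt _ h mem)
  · rintro rfl
    exact ⟨mem, fun l hl h => hl.not_ge (factorCount_le h)⟩

end Order

/-- The indices `α` with `leadCount r α = l`, by the range of the `x`-degree: `d < 0`, `r j < d` and
`0 ≤ d ≤ r j`. -/
def leadIndices (r l : ℕ) : Finset (ℤ × ℕ) :=
  ((range l).image fun j => (-((l - j : ℕ) : ℤ), j)) ∪
    (((range l).image fun j => (((r * j + (l - j) : ℕ) : ℤ), j)) ∪
      (range (r * l + 1)).image fun d : ℕ => ((d : ℤ), l))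

theorem mem_leadIndices {r l : ℕ} {α : ℤ × ℕ} : α ∈ leadIndices r l ↔ leadCount r α = l := by
  obtain ⟨d, j⟩ := α
  simp only [leadIndices, mem_union, mem_image, mem_range, Prod.mk.injEq, leadCount, lowering,
    raising]
  constructor
  · rintro (⟨j, hj, rfl, rfl⟩ | ⟨j, hj, rfl, rfl⟩ | ⟨d, hd, rfl, rfl⟩) <;> omega
  · intro h
    rcases lt_or_ge d 0 with hd | hd
    · exact Or.inl ⟨j, by omega, by omega, rfl⟩
    rcases lt_or_ge ((r * j : ℕ) : ℤ) d with hdj | hdj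
    · exact Or.inr (Or.inl ⟨j, by omega, by omega, rfl⟩)
    · obtain rfl : j = l := by omega
      exact Or.inr (Or.inr ⟨d.toNat, by omega, by omega, rfl⟩)

theorem card_leadIndices (r l : ℕ) : (leadIndices r l).card = (r + 2) * l + 1 := by
  rw [leadIndices, card_union_of_disjoint, card_union_of_disjoint, card_image_of_injective,
    card_image_of_injective, card_image_of_injective, card_range, card_range]
  · ring
  · exact fun d e h => Int.ofNat.inj (congrArg Prod.fst h)
  · exact fun i j h => congrArg Prod.snd h
  · exact fun i j h => congrArg Prod.snd h
  · simp only [disjoint_left, mem_image, mem_range, not_exists, not_and]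
    rintro _ ⟨j, hj, rfl⟩ d _ h
    exact hj.ne (congrArg Prod.snd h).symm
  · simp only [disjoint_left, mem_union, mem_image, mem_range, not_or, not_exists, not_and]
    rintro _ ⟨j, hj, rfl⟩
    refine ⟨fun i _ h => ?_, fun d _ h => ?_⟩ <;>
    · have := congrArg Prod.fst h
      dsimp only at this
      omega

theorem setOf_factorCount_eq (r k : ℕ) :
    {x | factorCount r x = k} = (((range (k + 1)).biUnion fun l =>
      leadIndices r l ×ˢ antidiagonal (k - l) : Finset _) : Set ((ℤ × ℕ) × ℕ × ℕ)) := by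
  ext x
  simp only [Set.mem_ofPred_eq, factorCount, coe_biUnion, Set.mem_iUnion, mem_coe, mem_range,
    mem_product, mem_leadIndices, HasAntidiagonal.mem_antidiagonal, exists_prop]
  constructor
  · rintro rfl
    exact ⟨leadCount r x.1, by omega, rfl, by omega⟩
  · rintro ⟨l, hl, rfl, h⟩
    omega

theorem sum_range_mul_add_one_mul_sub_add_one (s K : ℚ) (n : ℕ) :
    ∑ l ∈ range n, (s * l + 1) * (K - l + 1) =
      (K + 1) * n + (s * (K + 1) - 1) * (n * (n - 1) / 2) -
        s * ((n - 1) * n * (2 * n - 1) / 6) := by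
  induction n with
  | zero => simp
  | succ n ih => rw [Finset.sum_range_succ, ih]; push_cast; ring

theorem ncard_factorCount_eq (r k : ℕ) :
    ({x | factorCount r x = k}.ncard : ℚ) = ((k : ℚ) + 1) * (k + 2) * ((r + 2) * k + 3) / 6 := by
  rw [setOf_factorCount_eq, Set.ncard_coe_finset, card_biUnion]
  · calc ((∑ l ∈ range (k + 1), (leadIndices r l ×ˢ antidiagonal (k - l)).card : ℕ) : ℚ)
        = ∑ l ∈ range (k + 1), (((r + 2 : ℚ) * l + 1) * (k - l + 1)) := by
          rw [Nat.cast_sum]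
          refine Finset.sum_congr rfl fun l hl => ?_
          rw [card_product, card_leadIndices, Nat.card_antidiagonal, Nat.cast_mul, Nat.cast_succ,
            Nat.cast_succ, Nat.cast_sub (mem_range_succ_iff.1 hl)]
          push_cast
          rfl
      _ = _ := by
          rw [sum_range_mul_add_one_mul_sub_add_one]
          push_cast
          ring
  · intro l _ m _ hlm
    refine disjoint_left.2 fun x hx hx' => hlm ?_
    rw [mem_product, mem_leadIndices] at hx hx'
    exact hx.1.symm.trans hx'.1

theorem ncard_hasOrder (hU : (U : Set (ℂ × ℂ)).Nonempty) (k : ℕ) :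
    ({T ∈ bigMonomials U r p k | HasOrder U T k}.ncard : ℚ) =
      ((k : ℚ) + 1) * (k + 2) * ((r + 2) * k + 3) / 6 := by
  have eq_image : {T ∈ bigMonomials U r p k | HasOrder U T k} =
      basisMonomial U r p '' {x | factorCount r x = k} := by
    rw [bigMonomials_eq_image]
    ext T
    constructor
    · rintro ⟨⟨x, -, rfl⟩, h⟩
      exact ⟨x, (hasOrder_basisMonomial_iff hU x).1 h, rfl⟩
    · rintro ⟨x, hx, rfl⟩
      exact ⟨⟨x, hx.le, rfl⟩, (hasOrder_basisMonomial_iff hU x).2 hx⟩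
  rw [eq_image, Set.ncard_image_of_injective _ (linearIndependent_basisMonomial hU).injective,
    ncard_factorCount_eq]

end Staircase

end

theorem mainTheorem5_general (U : TopologicalSpace.Opens (ℂ × ℂ)) (hU : (U : Set (ℂ × ℂ)).Nonempty)
    (r p : ℕ) :
    (∀ q : ℕ,
      (∃ (hM : ∀ T ∈ Staircase.effMonomials U r p q, T ∈ Staircase.preserving U r p q)
        (hc : IsCompl (Staircase.distinguished U r p q)
          (LinearMap.ker (Staircase.restr U r p q))),
        LinearIndependent ℂ (fun T : Staircase.effMonomials U r p q =>
          Submodule.projection _ _ hc ⟨T, hM T T.2⟩) ∧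
        Submodule.span ℂ (Set.range fun T : Staircase.effMonomials U r p q =>
          Submodule.projection _ _ hc ⟨T, hM T T.2⟩) = Staircase.distinguishedDown U r p q) ∧
      (q * r ≤ p →
        FiniteDimensional ℂ (Staircase.distinguishedDown U r p q) ∧
        (Module.finrank ℂ (Staircase.distinguishedDown U r p q) : ℚ) =
          ((q : ℚ) + 1) * (q + 2) / 2 *
            (((p : ℚ) + 1) * (p + 1 - q * r) + (q : ℚ) * r ^ 2 / 12 * (3 * q + 1)))) ∧
    (∀ k : ℕ,
      LinearMap.range (Staircase.rho U r p k) ≤ Staircase.diffOpLE U k ∧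
      LinearIndependent ℂ (fun T : Staircase.bigMonomials U r p k =>
        (T : Staircase.Op U)) ∧
      Submodule.span ℂ (Staircase.bigMonomials U r p k) =
        LinearMap.range (Staircase.rho U r p k) ∧
      ({T ∈ Staircase.bigMonomials U r p k | Staircase.HasOrder U T k}.ncard : ℚ) =
        ((k : ℚ) + 1) * (k + 2) * ((r + 2) * k + 3) / 6) :=
  ⟨fun _ => ⟨⟨Staircase.effMonomials_subset_preserving, Staircase.isCompl_distinguished hU,
      Staircase.linearIndependent_projection_effMonomials hU _ _,
      Staircase.span_projection_effMonomials hU _ _⟩,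
    fun hq => ⟨Staircase.finiteDimensional_distinguishedDown hU, by
      rw [Staircase.finrank_distinguishedDown hU, Staircase.card_downPairs hq]⟩⟩,
  fun k => ⟨Staircase.range_rho_le k, Staircase.linearIndependent_bigMonomials hU k,
    Staircase.span_bigMonomials k, Staircase.ncard_hasOrder hU k⟩⟩

theorem mainTheorem5 (U : TopologicalSpace.Opens (ℂ × ℂ)) (hU : (U : Set (ℂ × ℂ)).Nonempty)
    (r : ℕ) (hr : 2 ≤ r) (p : ℕ) :
    (∀ q : ℕ,
      (∃ (hM : ∀ T ∈ Staircase.effMonomials U r p q, T ∈ Staircase.preserving U r p q)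
        (hc : IsCompl (Staircase.distinguished U r p q)
          (LinearMap.ker (Staircase.restr U r p q))),
        LinearIndependent ℂ (fun T : Staircase.effMonomials U r p q =>
          Submodule.projection _ _ hc ⟨T, hM T T.2⟩) ∧
        Submodule.span ℂ (Set.range fun T : Staircase.effMonomials U r p q =>
          Submodule.projection _ _ hc ⟨T, hM T T.2⟩) = Staircase.distinguishedDown U r p q) ∧
      (q * r ≤ p →
        FiniteDimensional ℂ (Staircase.distinguishedDown U r p q) ∧
        (Module.finrank ℂ (Staircase.distinguishedDown U r p q) : ℚ) =
          ((q : ℚ) + 1) * (q + 2) / 2 *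
            (((p : ℚ) + 1) * (p + 1 - q * r) + (q : ℚ) * r ^ 2 / 12 * (3 * q + 1)))) ∧
    (∀ k : ℕ,
      LinearMap.range (Staircase.rho U r p k) ≤ Staircase.diffOpLE U k ∧
      LinearIndependent ℂ (fun T : Staircase.bigMonomials U r p k =>
        (T : Staircase.Op U)) ∧
      Submodule.span ℂ (Staircase.bigMonomials U r p k) =
        LinearMap.range (Staircase.rho U r p k) ∧
      ({T ∈ Staircase.bigMonomials U r p k | Staircase.HasOrder U T k}.ncard : ℚ) =
        ((k : ℚ) + 1) * (k + 2) * ((r + 2) * k + 3) / 6) :=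
  mainTheorem5_general U hU r p
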